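/- Lemma 4.1 (Hamiltonian controls $H^1$). Let $A_0:\mathbb R^3\to\mathbb R$, $\underline A=(A_1,A_2,A_3)$ and $\partial_t\underline A=(\partial_tA_1,\partial_tA_2,\partial_tA_3)$ with components $\mathbb R^3\to\mathbb R$, and $\phi,\partial_t\phi:\mathbb R^3\to\mathbb C$ be given (the fields and their time derivatives at one fixed time; the subscript $\partial_t$ is only a label). For $R>0$ and $1<p\le\infty$ let $\mathcal L^p_R$ be the space of $f\in L^p(\mathbb R^3)$, with the $L^p$ norm, whose (distributional) Fourier transform $\hat f(\xi)=\int e^{-ix\cdot\xi}f(x)\,dx$ is supported in $|\xi|\le R$. For function spaces $X,Y$ and $C\ge 0$, $f\in C\,\mathrm{Ball}(X)$ means $f\in X$ and $\|f\|_X\le C$, and $f\in C\,\mathrm{Ball}(X+Y)$ means $f=g+h$ with $g\in C\,\mathrm{Ball}(X)$ and $h\in C\,\mathrm{Ball}(Y)$. Let $\|u\|_{H^1}=(\|u\|_{L^2}^2+\|\nabla u\|_{L^2}^2)^{1/2}$. Suppose that the fields are of class $[H^1]$, that is: $A_0\in\dot H^1(\mathbb R^3)$ (meaning that $A_0$ is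 locally integrable, its weak gradient is in $L^2$, and $A_0$ vanishes at infinity in the sense that $\{|A_0|>\varepsilon\}$ has finite measure for every $\varepsilon>0$), $A_j,\phi\in H^1(\mathbb R^3)$ and $\partial_tA_j,\partial_t\phi\in L^2(\mathbb R^3)$ for $j=1,2,3$. Suppose that $\nabla\cdot\underline A=0$ and $\nabla\cdot\partial_t\underline A=0$ in the sense of distributions. Let $$\mathcal H=\int_{\mathbb R^3}\tfrac12|\nabla A_0-\partial_t\underline A|^2+\tfrac12|\nabla\times\underline A|^2+\tfrac12|\partial_t\phi+iA_0\phi|^2+\tfrac12|\nabla\phi+i\underline A\phi|^2\,dx .$$ Then for every $K\ge0$ there is a constant $C$ depending only on $K$ (in particular not on the $[H^1]$ norms of the fields) such that $\mathcal H\le K$ implies, componentwise, 1. $A_0,\ A_j,\ \phi\in C\,\mathrm{Ball}(H^1+\mathcal L^6_1)$; 2. $\partial_kA_j,\ \partial_tA_j,\ \partial_k\phi,\ \partial_t\phi\in C\,\mathrm{Ball}(L^2+\mathcal L^3_2)$; 3. $\partial_kA_0,\ \partial_kA_j,\ \partial_tA_j\in C\,\mathrm{Ball}(L^2)$, for all $j,k\in\{1,2,3\}$.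 -/

import Mathlib

open MeasureTheory Distribution
open scoped ENNReal NNReal FourierTransform SchwartzMap

noncomputable section

namespace MKG

/-- Physical space `ℝ³` with the Euclidean norm. -/
abbrev R3 : Type := EuclideanSpace ℝ (Fin 3)

section Sobolev

variable {F : Type*} [NormedAddCommGroup F] [NormedSpace ℝ F]

/-- `g` is the weak partial derivative `∂_j f` on `ℝ³`: both are locally integrable and
`∫ (∂_j ψ) f = - ∫ ψ g` for every test function `ψ ∈ C_c^∞(ℝ³)`. -/
structure HasWeakPartial (j : Fin 3) (f g : R3 → F) : Prop where
  locallyIntegrable : LocallyIntegrable f volume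
  locallyIntegrable_deriv : LocallyIntegrable g volume
  integral_eq : ∀ ψ : R3 → ℝ, ContDiff ℝ ((⊤ : ℕ∞) : WithTop ℕ∞) ψ → HasCompactSupport ψ →
    ∫ x, (fderiv ℝ ψ x (EuclideanSpace.single j 1)) • f x = -∫ x, ψ x • g x

open Classical in
/-- The weak partial derivative `∂_j f` (unique up to a null set when it exists; `0` if `f` has
no weak partial derivative, a case that is always excluded where it is used). -/
def weakPartial (j : Fin 3) (f : R3 → F) : R3 → F :=
  if h : ∃ g, HasWeakPartial j f g then h.choose else 0

theorem hasWeakPartial_weakPartial {j : Fin 3} {f : R3 → F} (h : ∃ g, HasWeakPartial j f g) :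
    HasWeakPartial j f (weakPartial j f) := by
  unfold weakPartial
  rw [dif_pos h]
  exact h.choose_spec

/-- `f` has a weak gradient, and this gradient is in `L²(ℝ³)`. -/
def HasL2Gradient (f : R3 → F) : Prop :=
  ∀ j : Fin 3, ∃ g : R3 → F, HasWeakPartial j f g ∧ MemLp g 2 volume

/-- Membership in the inhomogeneous Sobolev space `H¹(ℝ³)`. -/
def MemH1 (f : R3 → F) : Prop :=
  MemLp f 2 volume ∧ HasL2Gradient f

/-- The norm of `H¹(ℝ³)`: the square root of `‖f‖_{L²}² + ‖∇f‖_{L²}²`, which by Plancherel is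
`‖⟨∇⟩ f‖_{L²}`. -/
def h1Norm (f : R3 → F) : ℝ≥0∞ :=
  (eLpNorm f 2 volume ^ 2 + ∑ j : Fin 3, eLpNorm (weakPartial j f) 2 volume ^ 2) ^ (1 / 2 : ℝ)

end Sobolev

/-- `f` vanishes at infinity in the measure sense: `{|f| > ε}` has finite measure for all `ε > 0`.
It singles out, among the functions with gradient in `L²(ℝ³)`, which form a space containing the
constants, the elements of the homogeneous Sobolev space `Ḣ¹(ℝ³)`. -/
def VanishesAtInfinity (f : R3 → ℝ) : Prop :=
  ∀ ε : ℝ, 0 < ε → volume {x | ε < |f x|} < ⊤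

/-- Membership in `Ḣ¹(ℝ³)`. -/
def MemHomogeneousH1 (f : R3 → ℝ) : Prop :=
  HasL2Gradient f ∧ VanishesAtInfinity f

/-- The (real) vector field `V` on `ℝ³` is divergence-free in the sense of distributions. -/
def IsDivergenceFree (V : Fin 3 → R3 → ℝ) : Prop :=
  ∀ ψ : R3 → ℝ, ContDiff ℝ ((⊤ : ℕ∞) : WithTop ℕ∞) ψ → HasCompactSupport ψ →
    ∫ x, ∑ j : Fin 3, fderiv ℝ ψ x (EuclideanSpace.single j 1) * V j x = 0

/-- The fields `A₀(t)`, `A[t] = (A(t), ∂ₜA(t))` and `φ[t] = (φ(t), ∂ₜφ(t))` at a fixed time `t`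
are of class `[H¹]`. -/
structure IsEnergyClass (A0 : R3 → ℝ) (A At : Fin 3 → R3 → ℝ) (φ φt : R3 → ℂ) : Prop where
  memA0 : MemHomogeneousH1 A0
  memA : ∀ j, MemH1 (A j)
  memAt : ∀ j, MemLp (At j) 2 volume
  memφ : MemH1 φ
  memφt : MemLp φt 2 volume

/-- The covariant time derivative `D₀ φ = ∂ₜφ + i A₀ φ`. -/
def covTime (A0 : R3 → ℝ) (φ φt : R3 → ℂ) (x : R3) : ℂ :=
  φt x + Complex.I * (A0 x : ℂ) * φ x

/-- The covariant spatial derivative `D_j φ = ∂_j φ + i A_j φ`. -/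
def covSpace (A : Fin 3 → R3 → ℝ) (φ : R3 → ℂ) (j : Fin 3) (x : R3) : ℂ :=
  weakPartial j φ x + Complex.I * (A j x : ℂ) * φ x

/-- The `j`-th component of the curl `∇ × A`; indices are taken modulo `3`. -/
def curl (A : Fin 3 → R3 → ℝ) (j : Fin 3) (x : R3) : ℝ :=
  weakPartial (j + 1) (A (j + 2)) x - weakPartial (j + 2) (A (j + 1)) x

/-- The Hamiltonian at a fixed time,
`∫ ½ |∇A₀ - ∂ₜA|² + ½ |∇ × A|² + ½ |D₀φ|² + ½ |Dφ|² dx`, an element of `[0, ∞]`. -/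
def hamiltonian (A0 : R3 → ℝ) (A At : Fin 3 → R3 → ℝ) (φ φt : R3 → ℂ) : ℝ≥0∞ :=
  ∫⁻ x, ENNReal.ofReal
    (1 / 2 * ∑ j : Fin 3, (weakPartial j A0 x - At j x) ^ 2
      + 1 / 2 * ∑ j : Fin 3, curl A j x ^ 2
      + 1 / 2 * ‖covTime A0 φ φt x‖ ^ 2
      + 1 / 2 * ∑ j : Fin 3, ‖covSpace A φ j x‖ ^ 2)

instance fact_one_le_three : Fact ((1 : ℝ≥0∞) ≤ 3) := ⟨by norm_num⟩

instance fact_one_le_six : Fact ((1 : ℝ≥0∞) ≤ 6) := ⟨by norm_num⟩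

/-- `f` belongs to the space of `L^p(ℝ³)` functions whose Fourier transform is supported in the
ball `|ξ| ≤ R`. Frequencies are taken for the Fourier transform with kernel `e^{-i x·ξ}`; Mathlib's
Fourier transform has the kernel `e^{-2πi x·η}`, so that `ξ = 2πη`. The Fourier transform and its
support are those of `f` as a tempered distribution. -/
def MemFreqLp (p : ℝ≥0∞) [Fact (1 ≤ p)] (R : ℝ) (f : R3 → ℂ) : Prop :=
  ∃ hf : MemLp f p volume,
    dsupport (𝓕 (Lp.toTemperedDistribution (hf.toLp f)) : 𝓢'(R3, ℂ)) ⊆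
      Metric.closedBall 0 (R / (2 * Real.pi))

/-- `f` is in the ball of radius `C` of `L²`. -/
def InBallL2 {F : Type*} [NormedAddCommGroup F] (C : ℝ≥0) (f : R3 → F) : Prop :=
  MemLp f 2 volume ∧ eLpNorm f 2 volume ≤ C

/-- `f` is in the ball of radius `C` of `H¹ + L⁶_1`. -/
def InBallH1AddL6 (C : ℝ≥0) (f : R3 → ℂ) : Prop :=
  ∃ g h : R3 → ℂ, f =ᵐ[volume] g + h ∧
    (MemH1 g ∧ h1Norm g ≤ C) ∧ (MemFreqLp 6 1 h ∧ eLpNorm h 6 volume ≤ C)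

/-- `f` is in the ball of radius `C` of `L² + L³_2`. -/
def InBallL2AddL3 (C : ℝ≥0) (f : R3 → ℂ) : Prop :=
  ∃ g h : R3 → ℂ, f =ᵐ[volume] g + h ∧
    InBallL2 C g ∧ (MemFreqLp 3 2 h ∧ eLpNorm h 3 volume ≤ C)

end MKG

end

/-!
The Hamiltonian controls `φ` only through its covariant derivatives; the point is to recover the
ordinary derivatives up to a low-frequency error.

*Energy bounds* (`exists_energyBounds`). Gradients of functions in `L⁶` are orthogonal in `L²` to
divergence-free fields (`integral_weakGradient_mul_eq_zero`). Hence `‖∇A₀ - ∂ₜA‖²` splits into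
`‖∇A₀‖² + ‖∂ₜA‖²`, and `‖∇ × A‖² = ‖∇A‖²`. The Sobolev inequality `‖f‖₆ ≲ ‖∇f‖₂` bounds the
potentials in `L⁶`, and its diamagnetic form (`diamagnetic_sobolev`), which rests on
`|∇|φ|| ≤ |Dφ|`, bounds `φ` in `L⁶`.

*High frequencies of the gauge terms* (`exists_gaugeTerm_bounds`). Let `κ` be a real Schwartz
function with integral `1` and Fourier transform supported in `|ξ| ≤ 1`. The low-frequency part of
`f` is `κ ∗ f`. Since `f - κ ∗ f = ∫ κ(y) (f - f(· - y)) dy`, the high-frequency part is controlled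
in `L²` by Minkowski's inequality as soon as `‖f - f(· - y)‖₂` grows at most polynomially in `y`
(`eLpNorm_two_sub_avg_lowKernel_le`). For a potential `a` and for `φ` the gradient is in `L² + L³`,
because `∂_k φ = D_k φ - i A_k φ` with `A_k φ ∈ L⁶ · L⁶`; together with the bounds in `L⁶` this puts
the differences of translates in `L³` (`eLpNorm_three_sub_translate_le`), and by Hölder's inequality
`L³ · L⁶ ⊆ L²` the differences of translates of `a φ` are in `L²`. So `a φ` is in `L³`, with its
high frequencies in `L²`.

*Conclusion.* In `∂_k φ = (D_k φ - (1 - κ ∗) i A_k φ) - κ ∗ (i A_k φ)` the first term is in `L²` and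
the second one in `L³` with low frequencies (`inBallL2AddL3_of_sub`); `∂ₜφ` is treated in the same
way. Consequently the high frequencies of `∇φ` are in `L²`. Removing the low frequencies of `φ` once
makes the gradient square integrable, and removing them a second time makes the function itself
square integrable; this is the decomposition in `H¹ + L⁶` (`inBallH1AddL6`), which applies to the
potentials as well.
-/

noncomputable section

namespace MKG

open Filter Topology Function

/-! ### Minkowski's integral inequality and averages of translates -/

section Minkowski

variable {X Y : Type*} [MeasurableSpace X] [MeasurableSpace Y] {μ : Measure X} {ν : Measure Y}

/-- Minkowski's integral inequality against a finite measure, for slices of norm at most `c`. Under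
this uniform bound it follows from Jensen's inequality and Tonelli's theorem. -/
theorem eLpNorm_lintegral_le_of_le [SFinite μ] [IsFiniteMeasure ν] {p : ℝ≥0∞} (hp : 1 ≤ p)
    (hp' : p ≠ ∞) {H : X → Y → ℝ≥0∞} (hH : AEMeasurable (uncurry H) (μ.prod ν)) {c : ℝ≥0∞}
    (hc : ∀ᵐ y ∂ν, eLpNorm (fun x => H x y) p μ ≤ c) :
    eLpNorm (fun x => ∫⁻ y, H x y ∂ν) p μ ≤ ν Set.univ * c := by
  have hp0 : p ≠ 0 := (zero_lt_one.trans_le hp).ne'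
  have hr : 1 ≤ p.toReal := by
    simpa using (ENNReal.toReal_le_toReal ENNReal.one_ne_top hp').2 hp
  have hr0 : 0 < p.toReal := zero_lt_one.trans_le hr
  set r := p.toReal with hrdef
  rw [eLpNorm_eq_lintegral_rpow_enorm_toReal hp0 hp', ← hrdef, one_div,
    ENNReal.rpow_inv_le_iff hr0]
  simp only [enorm_eq_self]
  have hslice : ∀ᵐ x ∂μ, AEMeasurable (fun y => H x y) ν := by
    have := hH.aestronglyMeasurable.prodMk_left
    filter_upwards [this] with x hx using hx.aemeasurable
  have hjensen : ∀ᵐ x ∂μ, (∫⁻ y, H x y ∂ν) ^ r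
      ≤ ν Set.univ ^ (r - 1) * ∫⁻ y, H x y ^ r ∂ν := by
    filter_upwards [hslice] with x hx
    have := eLpNorm'_le_eLpNorm'_mul_rpow_measure_univ (p := 1) (q := r) zero_lt_one hr
      hx.aestronglyMeasurable
    simp only [eLpNorm'_eq_lintegral_enorm, enorm_eq_self, ENNReal.rpow_one, ne_eq, one_ne_zero,
      not_false_eq_true, div_self] at this
    calc (∫⁻ y, H x y ∂ν) ^ r
        ≤ ((∫⁻ y, H x y ^ r ∂ν) ^ (1 / r) * ν Set.univ ^ (1 - 1 / r)) ^ r := by gcongr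
      _ = ν Set.univ ^ (r - 1) * ∫⁻ y, H x y ^ r ∂ν := by
        rw [ENNReal.mul_rpow_of_nonneg _ _ hr0.le, ← ENNReal.rpow_mul, ← ENNReal.rpow_mul,
          one_div_mul_cancel hr0.ne', ENNReal.rpow_one, mul_comm]
        congr 2
        field_simp
  have hHr : AEMeasurable (uncurry fun x y => H x y ^ r) (μ.prod ν) := hH.pow_const r
  calc ∫⁻ x, (∫⁻ y, H x y ∂ν) ^ r ∂μ
      ≤ ∫⁻ x, ν Set.univ ^ (r - 1) * ∫⁻ y, H x y ^ r ∂ν ∂μ := lintegral_mono_ae hjensen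
    _ = ν Set.univ ^ (r - 1) * ∫⁻ x, ∫⁻ y, H x y ^ r ∂ν ∂μ :=
        lintegral_const_mul'' _ hHr.lintegral_prod_right'
    _ = ν Set.univ ^ (r - 1) * ∫⁻ y, ∫⁻ x, H x y ^ r ∂μ ∂ν := by
        rw [lintegral_lintegral_swap hHr]
    _ ≤ ν Set.univ ^ (r - 1) * ∫⁻ _, c ^ r ∂ν := by
        refine mul_le_mul_right (lintegral_mono_ae ?_) _
        filter_upwards [hc] with y hy
        rw [eLpNorm_eq_lintegral_rpow_enorm_toReal hp0 hp', ← hrdef, one_div,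
          ENNReal.rpow_inv_le_iff hr0] at hy
        simpa using hy
    _ = (ν Set.univ * c) ^ r := by
        rw [lintegral_const, ENNReal.mul_rpow_of_nonneg _ _ hr0.le, mul_comm (c ^ r), ← mul_assoc]
        congr 1
        conv_lhs => rw [← ENNReal.rpow_one (ν Set.univ), ← ENNReal.rpow_mul, one_mul]
        rw [← ENNReal.rpow_add_of_nonneg _ _ (by linarith) zero_le_one]
        congr 1
        ring

/-- Minkowski's integral inequality with an integrable weight `w`, absorbed into the measure. -/
theorem eLpNorm_lintegral_mul_le [SFinite μ] [SFinite ν] {p : ℝ≥0∞} (hp : 1 ≤ p) (hp' : p ≠ ∞)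
    {w : Y → ℝ≥0∞} (hw : Measurable w) (hw' : ∫⁻ y, w y ∂ν ≠ ∞)
    {H : X → Y → ℝ≥0∞} (hH : AEMeasurable (uncurry H) (μ.prod ν)) {c : ℝ≥0∞}
    (hc : ∀ y, w y ≠ 0 → eLpNorm (fun x => H x y) p μ ≤ c) :
    eLpNorm (fun x => ∫⁻ y, w y * H x y ∂ν) p μ ≤ (∫⁻ y, w y ∂ν) * c := by
  have hfin : IsFiniteMeasure (ν.withDensity w) := isFiniteMeasure_withDensity hw'
  have hac : μ.prod (ν.withDensity w) ≪ μ.prod ν :=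
    Measure.AbsolutelyContinuous.rfl.prod (withDensity_absolutelyContinuous ν w)
  have h := eLpNorm_lintegral_le_of_le (ν := ν.withDensity w) hp hp' (hH.mono_ac hac) (c := c)
    ((ae_withDensity_iff hw).2 (Eventually.of_forall hc))
  rw [withDensity_apply _ MeasurableSet.univ, setLIntegral_univ] at h
  refine le_trans (le_of_eq (eLpNorm_congr_ae ?_)) h
  filter_upwards [hH.aestronglyMeasurable.prodMk_left] with x hx
  exact (lintegral_withDensity_eq_lintegral_mul₀ hw.aemeasurable hx.aemeasurable).symm

end Minkowski

section Translate

variable {F : Type*} [NormedAddCommGroup F]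

/-- The translate of `f` by `y`. -/
def translate (y : R3) (f : R3 → F) : R3 → F := fun x => f (x - y)

theorem eLpNorm_translate {f : R3 → F} (hf : AEStronglyMeasurable f volume) (p : ℝ≥0∞) (y : R3) :
    eLpNorm (translate y f) p volume = eLpNorm f p volume :=
  eLpNorm_comp_measurePreserving hf (measurePreserving_sub_right volume y)

theorem aestronglyMeasurable_translate {f : R3 → F} (hf : AEStronglyMeasurable f volume)
    (y : R3) : AEStronglyMeasurable (translate y f) volume :=
  hf.comp_measurePreserving (measurePreserving_sub_right volume y)

theorem aestronglyMeasurable_comp_sub {f : R3 → F} (hf : AEStronglyMeasurable f volume) :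
    AEStronglyMeasurable (fun z : R3 × R3 => f (z.1 - z.2)) (volume.prod volume) :=
  hf.comp_quasiMeasurePreserving (quasiMeasurePreserving_sub_of_right_invariant volume volume)

theorem eLpNorm_lintegral_translate_le {κ : R3 → ℝ} {f : R3 → F} {p : ℝ≥0∞}
    (hp : 1 ≤ p) (hp' : p ≠ ∞) (hκ : Continuous κ)
    (hκ' : Integrable κ volume) (hf : AEStronglyMeasurable f volume) :
    eLpNorm (fun x => ∫⁻ y, ‖κ y‖ₑ * ‖f (x - y)‖ₑ) p volume
      ≤ (∫⁻ y, ‖κ y‖ₑ) * eLpNorm f p volume := by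
  refine eLpNorm_lintegral_mul_le hp hp' hκ.measurable.enorm hκ'.2.ne
    (aestronglyMeasurable_comp_sub hf).enorm (fun y _ => ?_)
  rw [← eLpNorm_translate hf p y]
  exact le_of_eq (eLpNorm_enorm (translate y f))

end Translate

section Average

variable {F : Type*} [NormedAddCommGroup F] [NormedSpace ℝ F]

/-- The convolution `κ ∗ f`, that is, the average of the translates of `f` with weight `κ`. -/
def avg (κ : R3 → ℝ) (f : R3 → F) : R3 → F :=
  convolution κ f (ContinuousLinearMap.lsmul ℝ ℝ) volume

theorem avg_apply (κ : R3 → ℝ) (f : R3 → F) (x : R3) : avg κ f x = ∫ y, κ y • f (x - y) :=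
  convolution_lsmul

theorem aestronglyMeasurable_avg {κ : R3 → ℝ} {f : R3 → F} (hκ : AEStronglyMeasurable κ volume)
    (hf : AEStronglyMeasurable f volume) : AEStronglyMeasurable (avg κ f) volume :=
  (hκ.convolution_integrand (ContinuousLinearMap.lsmul ℝ ℝ) hf).integral_prod_right'

variable {κ : R3 → ℝ} {f : R3 → F} {p : ℝ≥0∞}

/-- Young's inequality `‖κ ∗ f‖_p ≤ ‖κ‖_1 ‖f‖_p`. -/
theorem eLpNorm_avg_le (hp : 1 ≤ p) (hp' : p ≠ ∞) (hκ : Continuous κ)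
    (hκ' : Integrable κ volume) (hf : AEStronglyMeasurable f volume) :
    eLpNorm (avg κ f) p volume ≤ (∫⁻ y, ‖κ y‖ₑ) * eLpNorm f p volume := by
  refine le_trans (eLpNorm_mono_enorm fun x => ?_)
    (eLpNorm_lintegral_translate_le hp hp' hκ hκ' hf)
  rw [avg_apply, enorm_eq_self]
  refine (enorm_integral_le_lintegral_enorm _).trans (le_of_eq ?_)
  simp_rw [enorm_smul]

theorem memLp_avg (hp : 1 ≤ p) (hp' : p ≠ ∞) (hκ : Continuous κ)
    (hκ' : Integrable κ volume) (hf : MemLp f p volume) : MemLp (avg κ f) p volume :=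
  ⟨aestronglyMeasurable_avg hκ.aestronglyMeasurable hf.1,
    (eLpNorm_avg_le hp hp' hκ hκ' hf.1).trans_lt (ENNReal.mul_lt_top hκ'.2 hf.2)⟩

/-- The integral defining `κ ∗ f` converges almost everywhere when `f ∈ L^p`. -/
theorem ae_integrable_smul_translate (hp : 1 ≤ p) (hp' : p ≠ ∞) (hκ : Continuous κ)
    (hκ' : Integrable κ volume) (hf : MemLp f p volume) :
    ∀ᵐ x, Integrable (fun y => κ y • f (x - y)) volume := by
  have hp0 : p ≠ 0 := (zero_lt_one.trans_le hp).ne'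
  have h1 := (eLpNorm_lintegral_translate_le hp hp' hκ hκ' hf.1).trans_lt
    (ENNReal.mul_lt_top hκ'.2 hf.2)
  rw [eLpNorm_lt_top_iff_lintegral_rpow_enorm_lt_top hp0 hp'] at h1
  have hm : AEMeasurable (fun z : R3 × R3 => ‖κ z.2‖ₑ * ‖f (z.1 - z.2)‖ₑ)
      (volume.prod volume) :=
    (hκ.measurable.comp measurable_snd).enorm.aemeasurable.mul
      (aestronglyMeasurable_comp_sub hf.1).enorm
  have h2 := ae_lt_top' ((hm.lintegral_prod_right').enorm.pow_const _) h1.ne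
  have h3 := (hκ.aestronglyMeasurable.convolution_integrand (μ := volume) (ν := volume)
    (ContinuousLinearMap.lsmul ℝ ℝ) hf.1).prodMk_left
  filter_upwards [h2, h3] with x hx hx'
  refine ⟨hx', ?_⟩
  rw [enorm_eq_self, ENNReal.rpow_lt_top_iff_of_pos (ENNReal.toReal_pos hp0 hp')] at hx
  rw [hasFiniteIntegral_iff_enorm]
  simpa [enorm_smul] using hx

/-- If `∫ κ = 1`, then `f - κ ∗ f` is an average of the differences `f - f(· - y)`, and inherits
their bounds. The weight `n` records how these bounds may grow with `y`. -/
theorem eLpNorm_sub_avg_le [CompleteSpace F] (hp : 1 ≤ p) (hp' : p ≠ ∞) (hκ : Continuous κ)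
    (hκ1 : ∫ y, κ y = 1)
    (hf : AEStronglyMeasurable f volume)
    (hfκ : ∀ᵐ x, Integrable (fun y => κ y • f (x - y)) volume)
    {n : R3 → ℝ≥0∞} (hn : Measurable n) (hn0 : ∀ y, n y ≠ 0) (hn' : ∀ y, n y ≠ ∞)
    (hκn : ∫⁻ y, ‖κ y‖ₑ * n y ≠ ∞) {c : ℝ≥0∞}
    (hc : ∀ y, κ y ≠ 0 → eLpNorm (f - translate y f) p volume ≤ c * n y) :
    eLpNorm (f - avg κ f) p volume ≤ (∫⁻ y, ‖κ y‖ₑ * n y) * c := by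
  have hκ' : Integrable κ volume := by
    by_contra h
    rw [integral_undef h] at hκ1
    exact zero_ne_one hκ1
  have hm : AEMeasurable (uncurry fun x y => ‖f x - f (x - y)‖ₑ * (n y)⁻¹)
      (volume.prod volume) :=
    ((hf.comp_fst.sub (aestronglyMeasurable_comp_sub hf)).enorm).mul
      (hn.comp measurable_snd).inv.aemeasurable
  have key : eLpNorm (fun x => ∫⁻ y, (‖κ y‖ₑ * n y) * (‖f x - f (x - y)‖ₑ * (n y)⁻¹)) p volume
      ≤ (∫⁻ y, ‖κ y‖ₑ * n y) * c := by
    refine eLpNorm_lintegral_mul_le hp hp' (hκ.measurable.enorm.mul hn) hκn hm (fun y hy => ?_)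
    have hy' : κ y ≠ 0 := by rintro h; simp [h] at hy
    have h1 := eLpNorm_le_mul_eLpNorm_of_ae_le_mul'' (c := (n y)⁻¹)
      (f := fun x => ‖f x - f (x - y)‖ₑ * (n y)⁻¹) (μ := volume) p
      (hf.sub (aestronglyMeasurable_translate hf y))
      (Eventually.of_forall fun x => le_of_eq (by rw [enorm_eq_self, mul_comm]; rfl))
    refine h1.trans ?_
    calc (n y)⁻¹ * eLpNorm (f - translate y f) p volume
        ≤ (n y)⁻¹ * (c * n y) := by gcongr; exact hc y hy'
      _ = c := by rw [mul_left_comm, ENNReal.inv_mul_cancel (hn0 y) (hn' y), mul_one]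
  refine le_trans (eLpNorm_mono_enorm_ae ?_) key
  filter_upwards [hfκ] with x hx
  have : (f - avg κ f) x = ∫ y, κ y • (f x - f (x - y)) := by
    simp_rw [smul_sub]
    rw [integral_sub (hκ'.smul_const _) hx, integral_smul_const, hκ1, one_smul, Pi.sub_apply,
      avg_apply]
  rw [this, enorm_eq_self]
  refine (enorm_integral_le_lintegral_enorm _).trans (le_of_eq (lintegral_congr fun y => ?_))
  rw [enorm_smul, mul_assoc, mul_left_comm (n y), ENNReal.mul_inv_cancel (hn0 y) (hn' y), mul_one]

end Average

/-! ### Mollification and weak derivatives -/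

/-- A smooth bump at the origin, of radius at most `2 / (n + 1)`. -/
def bump (n : ℕ) : ContDiffBump (0 : R3) where
  rIn := 1 / ((n : ℝ) + 1)
  rOut := 2 / ((n : ℝ) + 1)
  rIn_pos := by positivity
  rIn_lt_rOut := by gcongr; norm_num

/-- The mollifying kernel: the bump normalized to have integral one. -/
def mollifier (n : ℕ) : R3 → ℝ := (bump n).normed volume

theorem contDiff_mollifier (n : ℕ) (m : ℕ∞) : ContDiff ℝ m (mollifier n) :=
  (bump n).contDiff_normed

theorem continuous_mollifier (n : ℕ) : Continuous (mollifier n) :=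
  (contDiff_mollifier n 0).continuous

theorem hasCompactSupport_mollifier (n : ℕ) : HasCompactSupport (mollifier n) :=
  (bump n).hasCompactSupport_normed

theorem integral_mollifier (n : ℕ) : ∫ y, mollifier n y = 1 :=
  (bump n).integral_normed

theorem integrable_mollifier (n : ℕ) : Integrable (mollifier n) volume :=
  (bump n).integrable_normed

theorem lintegral_enorm_mollifier (n : ℕ) : ∫⁻ y, ‖mollifier n y‖ₑ = 1 := by
  have h := ofReal_integral_eq_lintegral_ofReal (integrable_mollifier n)
    (Eventually.of_forall fun y => (bump n).nonneg_normed y)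
  rw [integral_mollifier, ENNReal.ofReal_one] at h
  rw [h]
  exact lintegral_congr fun y => Real.enorm_of_nonneg ((bump n).nonneg_normed y)

theorem norm_lt_of_mollifier_ne_zero {n : ℕ} {y : R3} (h : mollifier n y ≠ 0) :
    ‖y‖ < 2 / ((n : ℝ) + 1) := by
  have : y ∈ Function.support (mollifier n) := h
  rw [mollifier, ContDiffBump.support_normed_eq, mem_ball_zero_iff] at this
  exact this

section

variable {F : Type*} [NormedAddCommGroup F] {f : R3 → F} {p : ℝ≥0∞}

/-- Continuity of translation in `L^p`. -/
theorem tendsto_eLpNorm_sub_translate (hp : 1 ≤ p) (hp' : p ≠ ∞) (hf : MemLp f p volume) :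
    Tendsto (fun y => eLpNorm (f - translate y f) p volume) (𝓝 0) (𝓝 0) := by
  have : Fact (1 ≤ p) := ⟨hp⟩
  let G : C(R3, C(R3, R3)) := ContinuousMap.curry ⟨fun z : R3 × R3 => z.2 - z.1, by fun_prop⟩
  have hG : ∀ y, MeasurePreserving (G y) volume volume :=
    fun y => measurePreserving_sub_right volume y
  have hcont : Continuous fun y => Lp.compMeasurePreserving (G y) (hG y) (hf.toLp f) :=
    Continuous.compMeasurePreservingLp continuous_const G.continuous hG hp'
  have h0 := (tendsto_iff_edist_tendsto_0.1 (hcont.tendsto 0))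
  refine h0.congr fun y => ?_
  rw [edist_comm, Lp.edist_def]
  refine eLpNorm_congr_ae ?_
  have e : ∀ y, (Lp.compMeasurePreserving (G y) (hG y) (hf.toLp f) : R3 → F)
      =ᵐ[volume] translate y f := fun y =>
    (Lp.coeFn_compMeasurePreserving _ (hG y)).trans
      ((hG y).quasiMeasurePreserving.ae_eq_comp hf.coeFn_toLp)
  filter_upwards [e 0, e y] with x h1 h2
  simp only [Pi.sub_apply, h1, h2]
  simp [translate]

/-- Fatou's lemma for `L^p` norms: bounds pass to almost everywhere limits. -/
theorem eLpNorm_le_of_tendsto {h : R3 → F} {u : ℕ → R3 → F} {c : ℕ → ℝ≥0∞} {C : ℝ≥0∞}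
    (hu : ∀ n, AEStronglyMeasurable (u n) volume)
    (hlim : ∀ᵐ x, Tendsto (fun n => u n x) atTop (𝓝 (h x)))
    (hc : ∀ n, eLpNorm (u n) p volume ≤ c n) (hC : Tendsto c atTop (𝓝 C)) :
    eLpNorm h p volume ≤ C :=
  (Lp.eLpNorm_lim_le_liminf_eLpNorm hu h hlim).trans
    ((liminf_le_liminf (Eventually.of_forall hc)).trans_eq hC.liminf_eq)

end

section

variable {F : Type*} [NormedAddCommGroup F] [NormedSpace ℝ F]

/-- The mollification of `f` at scale `2 / (n + 1)`. -/
def mollify (n : ℕ) (f : R3 → F) : R3 → F := avg (mollifier n) f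

variable {f g : R3 → F} {p : ℝ≥0∞}

theorem integrable_mollifier_smul (hf : LocallyIntegrable f volume) (n : ℕ) (x : R3) :
    Integrable (fun y => mollifier n y • f (x - y)) volume :=
  (hasCompactSupport_mollifier n).convolutionExists_left (ContinuousLinearMap.lsmul ℝ ℝ)
    (continuous_mollifier n) hf x

theorem contDiff_mollify (hf : LocallyIntegrable f volume) (n : ℕ) (m : ℕ∞) :
    ContDiff ℝ m (mollify n f) :=
  (hasCompactSupport_mollifier n).contDiff_convolution_left _ (contDiff_mollifier n m) hf

theorem continuous_mollify (hf : LocallyIntegrable f volume) (n : ℕ) :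
    Continuous (mollify n f) :=
  (contDiff_mollify hf n 0).continuous

theorem ae_tendsto_mollify [CompleteSpace F] (hf : LocallyIntegrable f volume) :
    ∀ᵐ x, Tendsto (fun n => mollify n f x) atTop (𝓝 (f x)) := by
  refine ContDiffBump.ae_convolution_tendsto_right_of_locallyIntegrable (φ := bump) (K := 2) ?_
    (Eventually.of_forall fun n => ?_) hf
  · have := tendsto_one_div_add_atTop_nhds_zero_nat (𝕜 := ℝ)
    simpa [bump, div_eq_mul_inv] using this.const_mul 2
  · simp [bump, div_eq_mul_inv]

theorem mollify_add (hf : LocallyIntegrable f volume) (hg : LocallyIntegrable g volume) (n : ℕ) :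
    mollify n (f + g) = mollify n f + mollify n g := by
  ext x
  simp only [mollify, avg_apply, Pi.add_apply, smul_add]
  exact integral_add (integrable_mollifier_smul hf n x) (integrable_mollifier_smul hg n x)

theorem eLpNorm_mollify_le (hp : 1 ≤ p) (hp' : p ≠ ∞) (hf : AEStronglyMeasurable f volume)
    (n : ℕ) : eLpNorm (mollify n f) p volume ≤ eLpNorm f p volume := by
  simpa [lintegral_enorm_mollifier, mollify] using
    eLpNorm_avg_le hp hp' (continuous_mollifier n) (integrable_mollifier n) hf

theorem memLp_mollify (hp : 1 ≤ p) (hp' : p ≠ ∞) (hf : MemLp f p volume) (n : ℕ) :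
    MemLp (mollify n f) p volume :=
  memLp_avg hp hp' (continuous_mollifier n) (integrable_mollifier n) hf

/-- Mollification turns weak partial derivatives into classical ones. -/
theorem fderiv_mollify [CompleteSpace F] {j : Fin 3} (h : HasWeakPartial j f g) (n : ℕ) (x : R3) :
    fderiv ℝ (mollify n f) x (EuclideanSpace.single j 1) = mollify n g x := by
  set L := ContinuousLinearMap.lsmul ℝ ℝ (E := F) with hL
  have hC := contDiff_mollifier n 1
  have h1 : HasFDerivAt (mollify n f) _ x :=
    (hasCompactSupport_mollifier n).hasFDerivAt_convolution_left L hC h.locallyIntegrable x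
  rw [h1.fderiv, convolution]
  have hint : Integrable (fun t => (L.precompL R3) (fderiv ℝ (mollifier n) t) (f (x - t)))
      volume :=
    ((hasCompactSupport_mollifier n).fderiv ℝ).convolutionExists_left (L.precompL R3)
      (hC.continuous_fderiv (by simp)) h.locallyIntegrable x
  rw [ContinuousLinearMap.integral_apply hint]
  simp only [ContinuousLinearMap.precompL_apply, hL, ContinuousLinearMap.lsmul_apply]
  have h2 := h.integral_eq (fun z => mollifier n (x - z))
    ((contDiff_mollifier n ⊤).comp (contDiff_const.sub contDiff_id))
    ((hasCompactSupport_mollifier n).comp_homeomorph (Homeomorph.subLeft x))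
  have h3 : ∀ z, fderiv ℝ (fun z => mollifier n (x - z)) z (EuclideanSpace.single j 1)
      = -fderiv ℝ (mollifier n) (x - z) (EuclideanSpace.single j 1) := by
    intro z
    have hd : HasFDerivAt (fun z => mollifier n (x - z))
        ((fderiv ℝ (mollifier n) (x - z)).comp (-ContinuousLinearMap.id ℝ R3)) z :=
      HasFDerivAt.comp z ((hC.differentiable (by simp)) (x - z)).hasFDerivAt
        ((hasFDerivAt_id z).const_sub x)
    rw [hd.fderiv]
    simp
  simp only [h3, neg_smul, integral_neg, neg_inj] at h2
  rw [← integral_sub_left_eq_self _ volume x]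
  simp only [sub_sub_cancel]
  rw [h2, mollify, avg, convolution_eq_swap]
  rfl

/-- Mollifications converge in `L^p`. -/
theorem tendsto_eLpNorm_sub_mollify [CompleteSpace F] (hp : 1 ≤ p) (hp' : p ≠ ∞)
    (hf : MemLp f p volume) :
    Tendsto (fun n => eLpNorm (f - mollify n f) p volume) atTop (𝓝 0) := by
  rw [ENNReal.tendsto_nhds_zero]
  intro ε hε
  have h1 := ENNReal.tendsto_nhds_zero.1 (tendsto_eLpNorm_sub_translate hp hp' hf) ε hε
  obtain ⟨δ, hδ, hball⟩ := Metric.eventually_nhds_iff.1 h1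
  have h2 : Tendsto (fun n : ℕ => 2 / ((n : ℝ) + 1)) atTop (𝓝 0) := by
    have := tendsto_one_div_add_atTop_nhds_zero_nat (𝕜 := ℝ)
    simpa [div_eq_mul_inv] using this.const_mul 2
  filter_upwards [h2.eventually_lt_const hδ] with n hn
  have h3 := eLpNorm_sub_avg_le hp hp' (continuous_mollifier n) (integral_mollifier n) hf.1
    (Eventually.of_forall (integrable_mollifier_smul (hf.locallyIntegrable hp) n))
    (n := fun _ => 1) measurable_const (by simp) (by simp)
    (by simp [lintegral_enorm_mollifier]) (c := ε) (fun y hy => by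
      rw [mul_one]
      exact hball (by simpa using (norm_lt_of_mollifier_ne_zero hy).trans hn))
  simpa [lintegral_enorm_mollifier, mollify] using h3

end

/-! ### Differences of translates -/

theorem ae_tendsto_translate {F : Type*} [NormedAddCommGroup F] {f : R3 → F} {u : ℕ → R3 → F}
    (h : ∀ᵐ x, Tendsto (fun n => u n x) atTop (𝓝 (f x))) (y : R3) :
    ∀ᵐ x, Tendsto (fun n => translate y (u n) x) atTop (𝓝 (translate y f x)) :=
  (measurePreserving_sub_right volume y).quasiMeasurePreserving.ae h

section

variable {F : Type*} [NormedAddCommGroup F] [NormedSpace ℝ F]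

theorem norm_le_sum_norm_apply_single (L : R3 →L[ℝ] F) :
    ‖L‖ ≤ ∑ j : Fin 3, ‖L (EuclideanSpace.single j 1)‖ := by
  refine L.opNorm_le_bound (Finset.sum_nonneg fun _ _ => norm_nonneg _) fun x => ?_
  have hx : x = ∑ j : Fin 3, x j • EuclideanSpace.single j (1 : ℝ) := by
    ext i
    simp [Pi.single_apply]
  conv_lhs => rw [hx, map_sum]
  rw [Finset.sum_mul]
  refine (norm_sum_le _ _).trans (Finset.sum_le_sum fun j _ => ?_)
  rw [map_smul, norm_smul, mul_comm]
  gcongr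
  exact PiLp.norm_apply_le x j

theorem enorm_le_sum_enorm_apply_single (L : R3 →L[ℝ] F) :
    ‖L‖ₑ ≤ ∑ j : Fin 3, ‖L (EuclideanSpace.single j 1)‖ₑ := by
  simp only [← ofReal_norm]
  rw [← ENNReal.ofReal_sum_of_nonneg fun _ _ => norm_nonneg _]
  exact ENNReal.ofReal_le_ofReal (norm_le_sum_norm_apply_single L)

/-- The average of `G` over the segment from `x` to `x - y`. It is additive in `G`, so that a
splitting of a gradient into pieces of different integrability carries over to differences of
translates. -/
def segAvg (y : R3) (G : R3 → ℝ≥0∞) (x : R3) : ℝ≥0∞ :=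
  ∫⁻ s in Set.Icc (0 : ℝ) 1, G (x - s • y)

theorem measurable_uncurry_seg {G : R3 → ℝ≥0∞} (hG : Measurable G) (y : R3) :
    Measurable (uncurry fun (x : R3) (s : ℝ) => G (x - s • y)) :=
  hG.comp (by fun_prop : Measurable fun z : R3 × ℝ => z.1 - z.2 • y)

theorem measurable_segAvg {G : R3 → ℝ≥0∞} (hG : Measurable G) (y : R3) :
    Measurable (segAvg y G) :=
  (measurable_uncurry_seg hG y).lintegral_prod_right'

theorem segAvg_add {G : R3 → ℝ≥0∞} (hG : Measurable G) (G' : R3 → ℝ≥0∞) (y x : R3) :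
    segAvg y (fun z => G z + G' z) x = segAvg y G x + segAvg y G' x :=
  lintegral_add_left (hG.comp (by fun_prop)) _

theorem eLpNorm_segAvg_le {p : ℝ≥0∞} (hp : 1 ≤ p) (hp' : p ≠ ∞) {G : R3 → ℝ≥0∞}
    (hG : Measurable G) (y : R3) : eLpNorm (segAvg y G) p volume ≤ eLpNorm G p volume := by
  have h := eLpNorm_lintegral_le_of_le (μ := (volume : Measure R3))
    (ν := volume.restrict (Set.Icc (0 : ℝ) 1)) hp hp'
    (H := fun (x : R3) (s : ℝ) => G (x - s • y)) (measurable_uncurry_seg hG y).aemeasurable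
    (c := eLpNorm G p volume) (Eventually.of_forall fun s => le_of_eq
      (eLpNorm_comp_measurePreserving hG.aestronglyMeasurable
        (measurePreserving_sub_right volume (s • y))))
  rw [Measure.restrict_apply_univ, Real.volume_Icc, sub_zero, ENNReal.ofReal_one, one_mul] at h
  exact h

/-- The fundamental theorem of calculus along the segment from `x - y` to `x`. -/
theorem enorm_sub_le_segAvg [CompleteSpace F] {h : R3 → F} (hh : ContDiff ℝ 1 h)
    {G : R3 → ℝ≥0∞} (hG : ∀ z, ‖fderiv ℝ h z‖ₑ ≤ G z) (y x : R3) :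
    ‖h x - h (x - y)‖ₑ ≤ ‖y‖ₑ * segAvg y G x := by
  have hd : ∀ s : ℝ, HasDerivAt (fun s : ℝ => h (x - s • y)) (fderiv ℝ h (x - s • y) (-y)) s := by
    intro s
    have h1 : HasDerivAt (fun s : ℝ => x - s • y) (-y) s := by
      simpa using ((hasDerivAt_id s).smul_const y).const_sub x
    exact ((hh.differentiable (by simp)) (x - s • y)).hasFDerivAt.comp_hasDerivAt s h1
  have hc : Continuous fun s : ℝ => fderiv ℝ h (x - s • y) (-y) :=
    ((hh.continuous_fderiv (by simp)).comp (by fun_prop)).clm_apply continuous_const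
  have h2 := intervalIntegral.integral_eq_sub_of_hasDerivAt (a := 0) (b := 1)
    (fun s _ => hd s) (hc.intervalIntegrable 0 1)
  simp only [one_smul, zero_smul, sub_zero] at h2
  rw [← enorm_neg, neg_sub, ← h2, intervalIntegral.integral_of_le zero_le_one,
    ← integral_Icc_eq_integral_Ioc]
  refine (enorm_integral_le_lintegral_enorm _).trans ?_
  have hm : Measurable fun s : ℝ => ‖fderiv ℝ h (x - s • y)‖ₑ :=
    (((hh.continuous_fderiv (by simp)).comp (by fun_prop :
      Continuous fun s : ℝ => x - s • y)).enorm).measurable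
  calc ∫⁻ s in Set.Icc (0 : ℝ) 1, ‖fderiv ℝ h (x - s • y) (-y)‖ₑ
      ≤ ∫⁻ s in Set.Icc (0 : ℝ) 1, ‖y‖ₑ * ‖fderiv ℝ h (x - s • y)‖ₑ := by
        refine lintegral_mono fun s => ?_
        rw [mul_comm, ← enorm_neg y]
        exact ContinuousLinearMap.le_opENorm _ _
    _ = ‖y‖ₑ * ∫⁻ s in Set.Icc (0 : ℝ) 1, ‖fderiv ℝ h (x - s • y)‖ₑ := lintegral_const_mul _ hm
    _ ≤ ‖y‖ₑ * segAvg y G x := by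
        gcongr
        exact lintegral_mono fun s => hG _

theorem eLpNorm_sub_translate_le_fderiv [CompleteSpace F] {p : ℝ≥0∞} (hp : 1 ≤ p) (hp' : p ≠ ∞)
    {h : R3 → F} (hh : ContDiff ℝ 1 h) (y : R3) :
    eLpNorm (h - translate y h) p volume ≤ ‖y‖ₑ * eLpNorm (fderiv ℝ h) p volume := by
  have hm : Measurable fun z => ‖fderiv ℝ h z‖ₑ :=
    (hh.continuous_fderiv (by simp)).enorm.measurable
  calc eLpNorm (h - translate y h) p volume
      ≤ ‖y‖ₑ * eLpNorm (segAvg y fun z => ‖fderiv ℝ h z‖ₑ) p volume :=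
        eLpNorm_le_mul_eLpNorm_of_ae_le_mul'' p (measurable_segAvg hm y).aestronglyMeasurable
          (Eventually.of_forall fun x => by
            rw [enorm_eq_self]
            exact enorm_sub_le_segAvg hh (fun z => le_rfl) y x)
    _ ≤ ‖y‖ₑ * eLpNorm (fderiv ℝ h) p volume := by
        gcongr
        exact (eLpNorm_segAvg_le hp hp' hm y).trans_eq (eLpNorm_enorm _)

theorem eLpNorm_fderiv_le_sum {p : ℝ≥0∞} (hp : 1 ≤ p) {h : R3 → F} (hh : ContDiff ℝ 1 h) :
    eLpNorm (fderiv ℝ h) p volume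
      ≤ ∑ j : Fin 3, eLpNorm (fun x => fderiv ℝ h x (EuclideanSpace.single j 1)) p volume := by
  have hm : ∀ j : Fin 3, AEStronglyMeasurable
      (fun x => ‖fderiv ℝ h x (EuclideanSpace.single j 1)‖ₑ) volume := fun j =>
    (((hh.continuous_fderiv (by simp)).clm_apply
      continuous_const).enorm).measurable.aestronglyMeasurable
  calc eLpNorm (fderiv ℝ h) p volume
      ≤ eLpNorm (∑ j : Fin 3, fun x => ‖fderiv ℝ h x (EuclideanSpace.single j 1)‖ₑ) p volume :=
        eLpNorm_mono_enorm fun x => by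
          rw [enorm_eq_self, Finset.sum_apply]
          exact enorm_le_sum_enorm_apply_single _
    _ ≤ ∑ j : Fin 3, eLpNorm (fun x => ‖fderiv ℝ h x (EuclideanSpace.single j 1)‖ₑ) p volume :=
        eLpNorm_sum_le (fun j _ => hm j) hp
    _ = _ := Finset.sum_congr rfl fun j _ => eLpNorm_enorm _

/-- `‖f - f(· - y)‖_p ≤ |y| ‖∇f‖_p` for weak gradients. -/
theorem HasWeakPartial.eLpNorm_sub_translate_le [CompleteSpace F] {p : ℝ≥0∞} (hp : 1 ≤ p)
    (hp' : p ≠ ∞) {f : R3 → F} {g : Fin 3 → R3 → F} (h : ∀ j, HasWeakPartial j f (g j)) (y : R3) :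
    eLpNorm (f - translate y f) p volume ≤ ‖y‖ₑ * ∑ j, eLpNorm (g j) p volume := by
  have hf := (h 0).locallyIntegrable
  have hlim := ae_tendsto_mollify hf
  refine eLpNorm_le_of_tendsto (u := fun n => mollify n f - translate y (mollify n f))
    (fun n => (continuous_mollify hf n).aestronglyMeasurable.sub
      (aestronglyMeasurable_translate (continuous_mollify hf n).aestronglyMeasurable y))
    ?_ (fun n => ?_) tendsto_const_nhds
  · filter_upwards [hlim, ae_tendsto_translate hlim y] with x h1 h2 using h1.sub h2
  · refine (eLpNorm_sub_translate_le_fderiv hp hp' (contDiff_mollify hf n 1) y).trans ?_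
    gcongr
    refine (eLpNorm_fderiv_le_sum hp (contDiff_mollify hf n 1)).trans
      (Finset.sum_le_sum fun j _ => ?_)
    simp only [fderiv_mollify (h j)]
    exact eLpNorm_mollify_le hp hp' (h j).locallyIntegrable_deriv.aestronglyMeasurable n

end

/-! ### The Sobolev inequality -/

/-- A smooth cutoff: `1` on the ball of radius `n + 1`, `0` off the ball of radius `2 (n + 1)`. -/
def cutoff (n : ℕ) (x : R3) : ℝ :=
  (⟨1, 2, one_pos, one_lt_two⟩ : ContDiffBump (0 : R3)) (((n : ℝ) + 1)⁻¹ • x)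

theorem contDiff_cutoff (n : ℕ) {m : ℕ∞} : ContDiff ℝ m (cutoff n) :=
  (ContDiffBump.contDiff _).comp (contDiff_const_smul _)

theorem hasCompactSupport_cutoff (n : ℕ) : HasCompactSupport (cutoff n) :=
  (ContDiffBump.hasCompactSupport _).comp_smul (by positivity)

theorem norm_cutoff_le_one (n : ℕ) (x : R3) : ‖cutoff n x‖ ≤ 1 := by
  rw [cutoff, Real.norm_of_nonneg (ContDiffBump.nonneg _)]
  exact ContDiffBump.le_one _

theorem cutoff_eq_one {n : ℕ} {x : R3} (h : ‖x‖ ≤ n + 1) : cutoff n x = 1 := by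
  refine ContDiffBump.one_of_mem_closedBall _ ?_
  rw [mem_closedBall_zero_iff, norm_smul, norm_inv, Real.norm_of_nonneg (by positivity)]
  exact inv_mul_le_one_of_le₀ h (by positivity)

theorem eventually_cutoff_eq_one (x : R3) : ∀ᶠ n in atTop, cutoff n x = 1 := by
  filter_upwards [eventually_ge_atTop ⌈‖x‖⌉₊] with n hn
  have h1 : (⌈‖x‖⌉₊ : ℝ) ≤ n := by exact_mod_cast hn
  exact cutoff_eq_one (by linarith [Nat.le_ceil ‖x‖])

theorem tendsto_cutoff (x : R3) : Tendsto (fun n => cutoff n x) atTop (𝓝 1) :=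
  tendsto_const_nhds.congr' ((eventually_cutoff_eq_one x).mono fun _ h => h.symm)

/-- The gradient of the cutoff at scale `n + 1` is `O(1 / (n + 1))`. -/
theorem exists_norm_fderiv_cutoff_le :
    ∃ M : ℝ≥0, ∀ n x, ‖fderiv ℝ (cutoff n) x‖ ≤ M * ((n : ℝ) + 1)⁻¹ := by
  set b : ContDiffBump (0 : R3) := ⟨1, 2, one_pos, one_lt_two⟩ with hb
  have hC : ContDiff ℝ 1 b := b.contDiff
  obtain ⟨M, hM⟩ := (b.hasCompactSupport.fderiv ℝ).exists_bound_of_continuous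
    (hC.continuous_fderiv (by simp))
  have hM0 : 0 ≤ M := (norm_nonneg _).trans (hM 0)
  refine ⟨⟨M, hM0⟩, fun n x => ?_⟩
  have h0 : HasFDerivAt (fun x : R3 => ((n : ℝ) + 1)⁻¹ • x)
      (((n : ℝ) + 1)⁻¹ • ContinuousLinearMap.id ℝ R3) x := (hasFDerivAt_id x).fun_const_smul _
  have h1 : HasFDerivAt (cutoff n) ((fderiv ℝ b (((n : ℝ) + 1)⁻¹ • x)).comp
      (((n : ℝ) + 1)⁻¹ • ContinuousLinearMap.id ℝ R3)) x :=
    HasFDerivAt.comp x ((hC.differentiable (by simp)) _).hasFDerivAt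
      h0
  rw [h1.fderiv, ContinuousLinearMap.comp_smul, norm_smul, ContinuousLinearMap.comp_id, mul_comm,
    norm_inv, Real.norm_of_nonneg (by positivity)]
  exact mul_le_mul_of_nonneg_right (hM _) (by positivity)

/-- The constant in the Sobolev inequality `‖h‖_6 ≤ C ‖∇h‖_2` for `h ∈ C_c^1(ℝ³)`. -/
def sobolevConst : ℝ≥0 := SNormLESNormFDerivOfEqConst ℝ (volume : Measure R3) 2

theorem sobolev_of_hasCompactSupport {h : R3 → ℝ} (hh : ContDiff ℝ 1 h)
    (hc : HasCompactSupport h) :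
    eLpNorm h 6 volume ≤ sobolevConst * eLpNorm (fderiv ℝ h) 2 volume := by
  have := eLpNorm_le_eLpNorm_fderiv_of_eq (volume : Measure R3) hh hc (p := 2) (p' := 6)
    (by norm_num) (by simp) (by simp; norm_num)
  exact_mod_cast this

/-- The Sobolev inequality for `C¹` functions in `L²`, by cutting off in space: the error term
`h ∇(cutoff n)` tends to zero in `L²`. -/
theorem sobolev_of_memLp {h : R3 → ℝ} (hh : ContDiff ℝ 1 h) (h2 : MemLp h 2 volume) :
    eLpNorm h 6 volume ≤ sobolevConst * eLpNorm (fderiv ℝ h) 2 volume := by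
  obtain ⟨M, hM⟩ := exists_norm_fderiv_cutoff_le
  have hfd := hh.continuous_fderiv (by simp)
  have hbound : ∀ n, eLpNorm (fun x => cutoff n x * h x) 6 volume ≤ sobolevConst *
      (eLpNorm (fderiv ℝ h) 2 volume
        + ENNReal.ofReal (M * ((n : ℝ) + 1)⁻¹) * eLpNorm h 2 volume) := by
    intro n
    have hcn : ContDiff ℝ 1 (cutoff n) := contDiff_cutoff n
    refine (sobolev_of_hasCompactSupport (hcn.mul hh)
      ((hasCompactSupport_cutoff n).mul_right)).trans ?_
    gcongr
    have hd : fderiv ℝ (fun x => cutoff n x * h x)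
        = (fun x => cutoff n x • fderiv ℝ h x) + fun x => h x • fderiv ℝ (cutoff n) x := by
      ext1 x
      exact fderiv_fun_mul (hcn.differentiable (by simp) x) (hh.differentiable (by simp) x)
    rw [hd]
    refine (eLpNorm_add_le (hcn.continuous.smul hfd).aestronglyMeasurable
      (hh.continuous.smul (hcn.continuous_fderiv (by simp))).aestronglyMeasurable
      (by norm_num)).trans (add_le_add ?_ ?_)
    · refine eLpNorm_mono fun x => ?_
      change ‖cutoff n x • fderiv ℝ h x‖ ≤ _
      rw [norm_smul]
      exact mul_le_of_le_one_left (norm_nonneg _) (norm_cutoff_le_one n x)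
    · refine eLpNorm_le_mul_eLpNorm_of_ae_le_mul (Eventually.of_forall fun x => ?_) 2
      change ‖h x • fderiv ℝ (cutoff n) x‖ ≤ _
      rw [norm_smul, mul_comm]
      exact mul_le_mul_of_nonneg_right (hM n x) (norm_nonneg _)
  refine eLpNorm_le_of_tendsto
    (fun n => ((contDiff_cutoff n (m := 0)).continuous.mul hh.continuous).aestronglyMeasurable)
    (Eventually.of_forall fun x => ?_) hbound ?_
  · simpa using (tendsto_cutoff x).mul_const (h x)
  · have h0 : Tendsto (fun n : ℕ => ENNReal.ofReal (M * ((n : ℝ) + 1)⁻¹)) atTop (𝓝 0) := by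
      have := (tendsto_one_div_add_atTop_nhds_zero_nat (𝕜 := ℝ)).const_mul (M : ℝ)
      simpa [one_div] using ENNReal.tendsto_ofReal this
    have h1 := (ENNReal.Tendsto.mul_const h0 (Or.inr h2.2.ne)).const_add
      (eLpNorm (fderiv ℝ h) 2 volume)
    have h2 := ENNReal.Tendsto.const_mul h1 (a := (sobolevConst : ℝ≥0∞))
      (Or.inr ENNReal.coe_ne_top)
    simpa using h2

/-- Passage to the limit in the Sobolev inequality along truncations `η n ∘ h` of `h`. -/
theorem sobolev_of_truncation {h : R3 → ℝ} (hh : ContDiff ℝ 1 h) {η : ℕ → ℝ → ℝ}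
    (hη : ∀ n, ContDiff ℝ 1 (η n)) {B : ℝ≥0} (hB : ∀ n t, ‖deriv (η n) t‖ ≤ B)
    (hlim : ∀ t, Tendsto (fun n => η n t) atTop (𝓝 t)) {S : ℝ≥0}
    (hS : ∀ n, eLpNorm (η n ∘ h) 6 volume ≤ S * eLpNorm (fderiv ℝ (η n ∘ h)) 2 volume) :
    eLpNorm h 6 volume ≤ (S * B : ℝ≥0) * eLpNorm (fderiv ℝ h) 2 volume := by
  refine eLpNorm_le_of_tendsto (u := fun n => η n ∘ h)
    (fun n => ((hη n).continuous.comp hh.continuous).aestronglyMeasurable)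
    (Eventually.of_forall fun x => hlim (h x)) (fun n => (hS n).trans ?_) tendsto_const_nhds
  rw [ENNReal.coe_mul, mul_assoc]
  gcongr
  refine (eLpNorm_le_mul_eLpNorm_of_ae_le_mul (c := B)
    (g := fderiv ℝ h) (Eventually.of_forall fun x => ?_) 2).trans_eq (by simp)
  have : fderiv ℝ (η n ∘ h) x = deriv (η n) (h x) • fderiv ℝ h x :=
    (((hη n).differentiable (by simp) _).hasDerivAt.comp_hasFDerivAt x
      (hh.differentiable (by simp) x).hasFDerivAt).fderiv
  rw [this, norm_smul]
  gcongr
  exact hB n _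

/-- The Sobolev inequality for `C¹` functions whose support has finite measure: composed with a
bounded function, they are in `L²`. -/
theorem sobolev_of_finite_support {h : R3 → ℝ} (hh : ContDiff ℝ 1 h)
    (hfin : volume {x | h x ≠ 0} < ∞) :
    eLpNorm h 6 volume ≤ (sobolevConst * 1 : ℝ≥0) * eLpNorm (fderiv ℝ h) 2 volume := by
  -- Bounded by `n + 1`, with slope at most `1`, and tending to the identity.
  set η : ℕ → ℝ → ℝ := fun n t => t / (1 + (t / (n + 1)) ^ 2) with hηdef
  have hpos : ∀ (n : ℕ) (t : ℝ), 0 < 1 + (t / (n + 1)) ^ 2 := fun n t => by positivity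
  have hη : ∀ n, ContDiff ℝ 1 (η n) := fun n =>
    contDiff_id.div (contDiff_const.add ((contDiff_id.div_const _).pow 2)) fun t => (hpos n t).ne'
  refine sobolev_of_truncation hh hη (fun n t => ?_) (fun t => ?_) (fun n => ?_)
  · have hd : HasDerivAt (η n) _ t :=
      (hasDerivAt_id t).div ((((hasDerivAt_id t).div_const ((n : ℝ) + 1)).pow 2).const_add 1)
        (hpos n t).ne'
    rw [hd.deriv, NNReal.coe_one]
    simp only [id]
    rw [norm_div, Real.norm_of_nonneg (by positivity : (0 : ℝ) ≤ (1 + (t / (↑n + 1)) ^ 2) ^ 2)]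
    refine div_le_one_of_le₀ ?_ (by positivity)
    have e : 1 * (1 + (t / ((n : ℝ) + 1)) ^ 2)
        - t * ((2 : ℕ) * (t / ((n : ℝ) + 1)) ^ (2 - 1) * (1 / ((n : ℝ) + 1)))
        = 1 - (t / ((n : ℝ) + 1)) ^ 2 := by
      simp only [Nat.cast_ofNat, Nat.reduceSub, pow_one]
      ring
    rw [e, Real.norm_eq_abs, abs_le]
    constructor <;> nlinarith [sq_nonneg (t / ((n : ℝ) + 1)),
      sq_nonneg ((t / ((n : ℝ) + 1)) ^ 2)]
  · have h1 : Tendsto (fun n : ℕ => t / ((n : ℝ) + 1)) atTop (𝓝 0) := by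
      simpa [div_eq_mul_inv] using
        (tendsto_one_div_add_atTop_nhds_zero_nat (𝕜 := ℝ)).const_mul t
    have h2 := (tendsto_const_nhds (x := t) (f := (atTop : Filter ℕ))).div
      ((h1.pow 2).const_add 1) (by norm_num)
    simpa [hηdef, Pi.div_def] using h2
  · refine sobolev_of_memLp ((hη n).comp hh) ?_
    have hb : ∀ t, ‖η n t‖ ≤ (n : ℝ) + 1 := by
      intro t
      rw [hηdef, Real.norm_eq_abs, abs_div, abs_of_pos (hpos n t), div_le_iff₀ (hpos n t), abs_le]
      have hn : (0 : ℝ) < (n : ℝ) + 1 := by positivity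
      have e : ((n : ℝ) + 1) * (1 + (t / (n + 1)) ^ 2)
          = (((n : ℝ) + 1) ^ 2 + t ^ 2) / (n + 1) := by field_simp
      rw [e, le_div_iff₀ hn, ← neg_div, div_le_iff₀ hn]
      constructor <;> nlinarith [sq_nonneg (t - (n + 1)), sq_nonneg (t + (n + 1))]
    have hmem : MemLp ({x | h x ≠ 0}.indicator fun _ => (n : ℝ) + 1) 2 volume :=
      memLp_indicator_const 2 (hh.continuous.measurable (measurableSet_singleton 0).compl) _
        (Or.inr hfin.ne)
    refine hmem.mono ((hη n).continuous.comp hh.continuous).aestronglyMeasurable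
      (Eventually.of_forall fun x => ?_)
    by_cases hx : h x = 0
    · simp [hx, hηdef]
    · rw [Set.indicator_of_mem (by exact hx)]
      exact (hb _).trans (le_abs_self _)

/-- A smooth function that vanishes near `0` and is the identity far from it. -/
def lowerTrunc (t : ℝ) : ℝ := t * Real.smoothTransition (t ^ 2 - 1)

theorem contDiff_lowerTrunc : ContDiff ℝ 1 lowerTrunc :=
  contDiff_id.mul (Real.smoothTransition.contDiff.comp ((contDiff_id.pow 2).sub contDiff_const))

theorem lowerTrunc_eq_zero {t : ℝ} (ht : |t| ≤ 1) : lowerTrunc t = 0 := by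
  rw [lowerTrunc, Real.smoothTransition.zero_of_nonpos, mul_zero]
  have := (sq_le_one_iff_abs_le_one t).2 ht
  linarith

theorem lowerTrunc_eq_self {t : ℝ} (ht : 2 ≤ t ^ 2) : lowerTrunc t = t := by
  rw [lowerTrunc, Real.smoothTransition.one_of_one_le (by linarith), mul_one]

theorem exists_norm_deriv_lowerTrunc_le : ∃ B : ℝ≥0, ∀ t, ‖deriv lowerTrunc t‖ ≤ B := by
  obtain ⟨B, hB⟩ := (isCompact_Icc (a := (-2 : ℝ)) (b := 2)).exists_bound_of_continuousOn
    (contDiff_lowerTrunc.continuous_deriv (by simp)).continuousOn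
  refine ⟨⟨max B 1, zero_le_one.trans (le_max_right _ _)⟩, fun t => ?_⟩
  by_cases ht : t ∈ Set.Icc (-2 : ℝ) 2
  · exact (hB t ht).trans (le_max_left _ _)
  · have h2 : 2 < t ^ 2 := by
      rw [Set.mem_Icc, not_and_or, not_le, not_le] at ht
      rcases ht with ht | ht <;> nlinarith
    have he : lowerTrunc =ᶠ[𝓝 t] id := by
      filter_upwards [(continuous_pow 2).continuousAt.eventually (lt_mem_nhds h2)] with s hs
      exact lowerTrunc_eq_self hs.le
    rw [he.deriv_eq, deriv_id, norm_one]
    exact le_max_right _ _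

/-- The Sobolev inequality for `C¹` functions that vanish at infinity in the measure sense: removing
the values of modulus at most `1 / (n + 1)` leaves a function whose support has finite measure. -/
theorem exists_sobolev_of_vanishesAtInfinity :
    ∃ S : ℝ≥0, ∀ h : R3 → ℝ, ContDiff ℝ 1 h → VanishesAtInfinity h →
      eLpNorm h 6 volume ≤ S * eLpNorm (fderiv ℝ h) 2 volume := by
  obtain ⟨B, hB⟩ := exists_norm_deriv_lowerTrunc_le
  refine ⟨sobolevConst * 1 * B, fun h hh hv => ?_⟩
  set η : ℕ → ℝ → ℝ := fun n t => ((n : ℝ) + 1)⁻¹ * lowerTrunc (((n : ℝ) + 1) * t) with hηdef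
  have hη : ∀ n, ContDiff ℝ 1 (η n) := fun n =>
    contDiff_const.mul (contDiff_lowerTrunc.comp (contDiff_const.mul contDiff_id))
  refine sobolev_of_truncation hh hη (fun n t => ?_) (fun t => ?_) (fun n => ?_)
  · have hn : (n : ℝ) + 1 ≠ 0 := by positivity
    have hd : HasDerivAt (η n) (((n : ℝ) + 1)⁻¹ *
        (deriv lowerTrunc (((n : ℝ) + 1) * t) * (((n : ℝ) + 1) * 1))) t :=
      (((contDiff_lowerTrunc.differentiable (by simp)) _).hasDerivAt.comp t
        ((hasDerivAt_id t).const_mul _)).const_mul _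
    rw [hd.deriv]
    convert hB (((n : ℝ) + 1) * t) using 2
    field_simp
  · by_cases ht : t = 0
    · simp [hηdef, ht, lowerTrunc]
    refine tendsto_const_nhds.congr' ?_
    have h1 : Tendsto (fun n : ℕ => (((n : ℝ) + 1) * t) ^ 2) atTop atTop := by
      have : Tendsto (fun n : ℕ => ((n : ℝ) + 1) ^ 2) atTop atTop :=
        (tendsto_pow_atTop two_ne_zero).comp
          (tendsto_atTop_add_const_right _ _ tendsto_natCast_atTop_atTop)
      simpa [mul_pow] using this.atTop_mul_const (by positivity : 0 < t ^ 2)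
    filter_upwards [h1.eventually_ge_atTop 2] with n hn
    have hn' : (n : ℝ) + 1 ≠ 0 := by positivity
    rw [hηdef]
    simp only
    rw [lowerTrunc_eq_self hn, inv_mul_cancel_left₀ hn']
  · refine sobolev_of_finite_support ((hη n).comp hh) ?_
    refine (measure_mono fun x hx => ?_).trans_lt (hv ((n : ℝ) + 1)⁻¹ (by positivity))
    simp only [Set.mem_ofPred_eq] at hx ⊢
    by_contra hcon
    refine hx ?_
    simp only [hηdef, comp_apply]
    rw [lowerTrunc_eq_zero, mul_zero]
    rw [abs_mul, abs_of_pos (by positivity : (0 : ℝ) < (n : ℝ) + 1)]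
    rw [not_lt] at hcon
    calc ((n : ℝ) + 1) * |h x| ≤ ((n : ℝ) + 1) * ((n : ℝ) + 1)⁻¹ := by gcongr
      _ = 1 := mul_inv_cancel₀ (by positivity)

theorem vanishesAtInfinity_of_memLp {f : R3 → ℝ} (hf : MemLp f 2 volume) :
    VanishesAtInfinity f := by
  intro ε hε
  refine (measure_mono fun x hx => ?_).trans_lt
    (hf.meas_ge_lt_top two_ne_zero ENNReal.ofNat_ne_top (ε := ε.toNNReal)
      (Real.toNNReal_pos.2 hε).ne')
  exact Real.toNNReal_le_iff_le_coe.2 (le_of_lt hx : ε ≤ |f x|)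

theorem VanishesAtInfinity.of_sub_memLp {f h : R3 → ℝ} (hf : VanishesAtInfinity f)
    (hfh : MemLp (f - h) 2 volume) : VanishesAtInfinity h := by
  intro ε hε
  refine (measure_mono (fun x (hx : ε < |h x|) => ?_)).trans_lt ((measure_union_le _ _).trans_lt
    (ENNReal.add_lt_top.2 ⟨hf (ε / 2) (by positivity),
      vanishesAtInfinity_of_memLp hfh (ε / 2) (by positivity)⟩))
  by_contra hcon
  simp only [Set.mem_union, Set.mem_ofPred_eq, not_or, not_lt, Pi.sub_apply] at hcon
  have := abs_sub_abs_le_abs_sub (h x) (f x)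
  rw [abs_sub_comm] at this
  linarith [hcon.1, hcon.2]

/-- Mollification moves a function with weak gradient in `L^p` by an `L^p` function. -/
theorem HasWeakPartial.memLp_sub_mollify {F : Type*} [NormedAddCommGroup F] [NormedSpace ℝ F]
    [CompleteSpace F] {p : ℝ≥0∞} (hp : 1 ≤ p) (hp' : p ≠ ∞)
    {f : R3 → F} {g : Fin 3 → R3 → F} (h : ∀ j, HasWeakPartial j f (g j))
    (hg : ∀ j, MemLp (g j) p volume) (n : ℕ) : MemLp (f - mollify n f) p volume := by
  have hf := (h 0).locallyIntegrable
  refine ⟨hf.aestronglyMeasurable.sub (continuous_mollify hf n).aestronglyMeasurable, ?_⟩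
  have h3 := eLpNorm_sub_avg_le hp hp' (continuous_mollifier n) (integral_mollifier n)
    hf.aestronglyMeasurable (Eventually.of_forall (integrable_mollifier_smul hf n))
    (n := fun _ => 1) measurable_const (by simp) (by simp)
    (by simp [lintegral_enorm_mollifier]) (c := ENNReal.ofReal 2 * ∑ j, eLpNorm (g j) p volume)
    (fun y hy => by
      rw [mul_one]
      refine (HasWeakPartial.eLpNorm_sub_translate_le hp hp' h y).trans ?_
      gcongr
      rw [← ofReal_norm]
      refine ENNReal.ofReal_le_ofReal ((norm_lt_of_mollifier_ne_zero hy).le.trans ?_)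
      exact div_le_self zero_le_two (by simp))
  refine h3.trans_lt ?_
  simp only [mul_one, lintegral_enorm_mollifier, one_mul]
  exact ENNReal.mul_lt_top ENNReal.ofReal_lt_top (ENNReal.sum_lt_top.2 fun j _ => (hg j).2)

/-- The Sobolev inequality on `Ḣ¹(ℝ³)`. Mollification keeps the condition at infinity, because it
moves the function by an `L²` function. -/
theorem exists_sobolev_weak :
    ∃ S : ℝ≥0, ∀ (f : R3 → ℝ) (g : Fin 3 → R3 → ℝ), (∀ j, HasWeakPartial j f (g j)) →
      (∀ j, MemLp (g j) 2 volume) → VanishesAtInfinity f →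
      eLpNorm f 6 volume ≤ S * ∑ j, eLpNorm (g j) 2 volume := by
  obtain ⟨S, hS⟩ := exists_sobolev_of_vanishesAtInfinity
  refine ⟨S, fun f g h hg hv => ?_⟩
  have hf := (h 0).locallyIntegrable
  refine eLpNorm_le_of_tendsto (u := fun n => mollify n f)
    (fun n => (continuous_mollify hf n).aestronglyMeasurable) (ae_tendsto_mollify hf)
    (fun n => ?_) tendsto_const_nhds
  refine (hS _ (contDiff_mollify hf n 1) (hv.of_sub_memLp
    (HasWeakPartial.memLp_sub_mollify one_le_two ENNReal.ofNat_ne_top h hg n))).trans ?_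
  gcongr
  refine (eLpNorm_fderiv_le_sum one_le_two (contDiff_mollify hf n 1)).trans
    (Finset.sum_le_sum fun j _ => ?_)
  simp only [fderiv_mollify (h j)]
  exact eLpNorm_mollify_le one_le_two ENNReal.ofNat_ne_top (hg j).1 n

/-! ### The diamagnetic inequality -/

/-- The regularized modulus `√(|z|² + δ²) - δ`, smooth for `δ > 0` and zero at the origin. -/
def regAbs (δ : ℝ) (z : ℂ) : ℝ := √(‖z‖ ^ 2 + δ ^ 2) - δ

theorem norm_regAbs_le {δ : ℝ} (hδ : 0 < δ) (z : ℂ) : ‖regAbs δ z‖ ≤ ‖z‖ := by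
  have h1 : δ ≤ √(‖z‖ ^ 2 + δ ^ 2) := Real.le_sqrt_of_sq_le (by nlinarith [sq_nonneg ‖z‖])
  have h2 : √(‖z‖ ^ 2 + δ ^ 2) ≤ ‖z‖ + δ :=
    Real.sqrt_le_iff.2 ⟨by positivity, by nlinarith [norm_nonneg z]⟩
  rw [regAbs, Real.norm_of_nonneg (by linarith)]
  linarith

theorem contDiff_regAbs {δ : ℝ} (hδ : 0 < δ) : ContDiff ℝ 1 (regAbs δ) :=
  (((contDiff_norm_sq ℝ).add contDiff_const).sqrt fun z => by positivity).sub contDiff_const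

/-- The directional derivative of `√(|h|² + δ²) - δ`, when the derivative of `h` is `w`. -/
def regSlope (δ : ℝ) (z w : ℂ) : ℝ := inner ℝ z w / √(‖z‖ ^ 2 + δ ^ 2)

theorem norm_le_sqrt_add_sq (δ : ℝ) (z : ℂ) : ‖z‖ ≤ √(‖z‖ ^ 2 + δ ^ 2) :=
  Real.le_sqrt_of_sq_le (by nlinarith [sq_nonneg δ])

theorem norm_regSlope_le {δ : ℝ} (hδ : 0 < δ) (z w : ℂ) : ‖regSlope δ z w‖ ≤ ‖w‖ := by
  have hpos : 0 < √(‖z‖ ^ 2 + δ ^ 2) := Real.sqrt_pos.2 (by positivity)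
  rw [regSlope, norm_div, Real.norm_of_nonneg hpos.le, div_le_iff₀ hpos, mul_comm ‖w‖]
  exact (norm_inner_le_norm z w).trans
    (mul_le_mul_of_nonneg_right (norm_le_sqrt_add_sq δ z) (norm_nonneg _))

theorem regSlope_sub (δ : ℝ) (z w w' : ℂ) :
    regSlope δ z (w - w') = regSlope δ z w - regSlope δ z w' := by
  simp only [regSlope, inner_sub_right, sub_div]

/-- The gauge term `i a z` is orthogonal to `z`, and does not contribute to the slope of `|z|`. -/
theorem regSlope_add_gauge (δ a : ℝ) (z w : ℂ) :
    regSlope δ z (w + Complex.I * (a : ℂ) * z) = regSlope δ z w := by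
  have : inner ℝ z (Complex.I * (a : ℂ) * z) = (0 : ℝ) := by
    simp [Complex.inner]
    ring
  rw [regSlope, regSlope, inner_add_right, this, add_zero]

theorem fderiv_regAbs_comp {δ : ℝ} (hδ : 0 < δ) {h : R3 → ℂ} (hh : ContDiff ℝ 1 h) (x v : R3) :
    fderiv ℝ (regAbs δ ∘ h) x v = regSlope δ (h x) (fderiv ℝ h x v) := by
  have h1 := (((hh.differentiable (by simp) x).hasFDerivAt.norm_sq).add_const (δ ^ 2)).sqrt
    (by positivity : ‖h x‖ ^ 2 + δ ^ 2 ≠ 0)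
  have h2 : HasFDerivAt (regAbs δ ∘ h) _ x := h1.sub_const δ
  rw [h2.fderiv, regSlope]
  simp only [smul_apply, ContinuousLinearMap.comp_apply, innerSL_apply_apply,
    smul_eq_mul, nsmul_eq_mul, Nat.cast_ofNat]
  field_simp

theorem continuous_regSlope {δ : ℝ} (hδ : 0 < δ) :
    Continuous fun z : ℂ × ℂ => regSlope δ z.1 z.2 := by
  refine Continuous.div (by fun_prop) (by fun_prop) fun z => ?_
  exact (Real.sqrt_pos.2 (by positivity)).ne'

theorem tendsto_eLpNorm_of_dominated {E : Type*} [NormedAddCommGroup E]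
    {u : ℕ → R3 → ℝ} {v : R3 → ℝ} {G : R3 → E}
    (hu : ∀ n, AEStronglyMeasurable (u n) volume) (hG : MemLp G 2 volume)
    (hdom : ∀ n x, ‖u n x‖ ≤ ‖G x‖)
    (hlim : ∀ᵐ x, Tendsto (fun n => u n x) atTop (𝓝 (v x))) :
    Tendsto (fun n => eLpNorm (u n) 2 volume) atTop (𝓝 (eLpNorm v 2 volume)) := by
  simp only [eLpNorm_eq_lintegral_rpow_enorm_toReal two_ne_zero ENNReal.ofNat_ne_top]
  refine (ENNReal.continuous_rpow_const.tendsto _).comp ?_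
  refine tendsto_lintegral_of_dominated_convergence' (fun x => ‖G x‖ₑ ^ (2 : ℝ≥0∞).toReal)
    (fun n => (hu n).enorm.pow_const _) (fun n => Eventually.of_forall fun x => ?_) ?_ ?_
  · exact ENNReal.rpow_le_rpow (enorm_le_iff_norm_le.2 (hdom n x)) ENNReal.toReal_nonneg
  · exact ((eLpNorm_lt_top_iff_lintegral_rpow_enorm_lt_top two_ne_zero
      ENNReal.ofNat_ne_top).1 hG.2).ne
  · filter_upwards [hlim] with x hx
    exact (ENNReal.continuous_rpow_const.tendsto _).comp hx.enorm

theorem aestronglyMeasurable_regSlope {δ : ℝ} (hδ : 0 < δ) {u w : R3 → ℂ}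
    (hu : AEStronglyMeasurable u volume) (hw : AEStronglyMeasurable w volume) :
    AEStronglyMeasurable (fun x => regSlope δ (u x) (w x)) volume :=
  (continuous_regSlope hδ).comp_aestronglyMeasurable (hu.prodMk hw)

theorem eLpNorm_regSlope_le {δ : ℝ} (hδ : 0 < δ) {u w w' : R3 → ℂ}
    (hu : AEStronglyMeasurable u volume) (hw : AEStronglyMeasurable w volume)
    (hw' : AEStronglyMeasurable w' volume) :
    eLpNorm (fun x => regSlope δ (u x) (w' x)) 2 volume
      ≤ eLpNorm (w - w') 2 volume + eLpNorm (fun x => regSlope δ (u x) (w x)) 2 volume := by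
  have hsplit : (fun x => regSlope δ (u x) (w' x))
      = (fun x => regSlope δ (u x) (w x)) - fun x => regSlope δ (u x) ((w - w') x) := by
    ext x
    simp only [Pi.sub_apply, regSlope_sub]
    ring
  rw [hsplit, add_comm]
  refine (eLpNorm_sub_le (aestronglyMeasurable_regSlope hδ hu hw)
    (aestronglyMeasurable_regSlope hδ hu (hw.sub hw')) one_le_two).trans (add_le_add le_rfl ?_)
  exact eLpNorm_mono fun x => norm_regSlope_le hδ _ _

theorem eLpNorm_regAbs_le {δ : ℝ} (hδ : 0 < δ) {h : R3 → ℂ} (hC : ContDiff ℝ 1 h)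
    (h2 : MemLp h 2 volume) :
    eLpNorm (regAbs δ ∘ h) 6 volume ≤ sobolevConst * ∑ j : Fin 3, eLpNorm
      (fun x => regSlope δ (h x) (fderiv ℝ h x (EuclideanSpace.single j 1))) 2 volume := by
  have hr : ContDiff ℝ 1 (regAbs δ ∘ h) := (contDiff_regAbs hδ).comp hC
  have hmem : MemLp (regAbs δ ∘ h) 2 volume :=
    h2.mono hr.continuous.aestronglyMeasurable
      (Eventually.of_forall fun x => norm_regAbs_le hδ _)
  refine (sobolev_of_memLp hr hmem).trans (mul_le_mul_right ?_ _)
  refine (eLpNorm_fderiv_le_sum one_le_two hr).trans (le_of_eq ?_)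
  simp only [fderiv_regAbs_comp hδ hC]

theorem tendsto_regSlope {δ : ℝ} (hδ : 0 < δ) {u : ℕ → ℂ} {a : ℂ}
    (hu : Tendsto u atTop (𝓝 a)) (b : ℂ) :
    Tendsto (fun n => regSlope δ (u n) b) atTop (𝓝 (regSlope δ a b)) := by
  have hc : Continuous fun z : ℂ => regSlope δ z b :=
    (continuous_regSlope hδ).comp (Continuous.prodMk_left b)
  exact (hc.tendsto a).comp hu

/-- The Sobolev inequality for the regularized modulus. For mollifications of `φ` the slope of the
modulus is computed classically; the gauge term enters only in the limit, where the slope is taken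
at `φ` itself and is not affected by it. -/
theorem diamagnetic_sobolev_regAbs {φ : R3 → ℂ} {g : Fin 3 → R3 → ℂ} {A : Fin 3 → R3 → ℝ}
    (h : ∀ j, HasWeakPartial j φ (g j)) (hφ : MemLp φ 2 volume) (hg : ∀ j, MemLp (g j) 2 volume)
    {δ : ℝ} (hδ : 0 < δ) :
    eLpNorm (regAbs δ ∘ φ) 6 volume ≤ sobolevConst *
      ∑ j, eLpNorm (fun x => g j x + Complex.I * (A j x : ℂ) * φ x) 2 volume := by
  have hf := (h 0).locallyIntegrable
  have hlim := ae_tendsto_mollify hf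
  have hstep : ∀ n, eLpNorm (regAbs δ ∘ mollify n φ) 6 volume ≤ sobolevConst *
      ∑ j, (eLpNorm (g j - mollify n (g j)) 2 volume
        + eLpNorm (fun x => regSlope δ (mollify n φ x) (g j x)) 2 volume) := by
    intro n
    refine (eLpNorm_regAbs_le hδ (contDiff_mollify hf n 1)
      (memLp_mollify one_le_two ENNReal.ofNat_ne_top hφ n)).trans
      (mul_le_mul_right (Finset.sum_le_sum fun j _ => ?_) _)
    simp only [fderiv_mollify (h j)]
    exact eLpNorm_regSlope_le hδ (continuous_mollify hf n).aestronglyMeasurable (hg j).1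
      (continuous_mollify (h j).locallyIntegrable_deriv n).aestronglyMeasurable
  have hlimc : Tendsto (fun n => (sobolevConst : ℝ≥0∞) *
      ∑ j, (eLpNorm (g j - mollify n (g j)) 2 volume
        + eLpNorm (fun x => regSlope δ (mollify n φ x) (g j x)) 2 volume)) atTop
      (𝓝 (sobolevConst * ∑ j, (0 + eLpNorm (fun x => regSlope δ (φ x) (g j x)) 2 volume))) := by
    refine ENNReal.Tendsto.const_mul (tendsto_finsetSum _ fun j _ => Tendsto.add
      (tendsto_eLpNorm_sub_mollify one_le_two ENNReal.ofNat_ne_top (hg j))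
      (tendsto_eLpNorm_of_dominated (fun n => aestronglyMeasurable_regSlope hδ
        (continuous_mollify hf n).aestronglyMeasurable (hg j).1) (hg j)
        (fun n x => norm_regSlope_le hδ _ _) ?_)) (Or.inr ENNReal.coe_ne_top)
    filter_upwards [hlim] with x hx using tendsto_regSlope hδ hx _
  refine (eLpNorm_le_of_tendsto (u := fun n => regAbs δ ∘ mollify n φ)
    (fun n => ((contDiff_regAbs hδ).continuous.comp
      (continuous_mollify hf n)).aestronglyMeasurable) ?_ hstep hlimc).trans ?_
  · filter_upwards [hlim] with x hx
    exact ((contDiff_regAbs hδ).continuous.tendsto _).comp hx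
  · refine mul_le_mul_right (Finset.sum_le_sum fun j _ => ?_) _
    rw [zero_add]
    refine eLpNorm_mono fun x => ?_
    rw [← regSlope_add_gauge δ (A j x)]
    exact norm_regSlope_le hδ _ _

/-- The diamagnetic Sobolev inequality: the covariant gradient controls the modulus of `φ`. -/
theorem diamagnetic_sobolev {φ : R3 → ℂ} {g : Fin 3 → R3 → ℂ} {A : Fin 3 → R3 → ℝ}
    (h : ∀ j, HasWeakPartial j φ (g j)) (hφ : MemLp φ 2 volume) (hg : ∀ j, MemLp (g j) 2 volume) :
    eLpNorm φ 6 volume ≤ sobolevConst *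
      ∑ j, eLpNorm (fun x => g j x + Complex.I * (A j x : ℂ) * φ x) 2 volume := by
  rw [← eLpNorm_norm]
  refine eLpNorm_le_of_tendsto (u := fun n : ℕ => regAbs (1 / ((n : ℝ) + 1)) ∘ φ)
    (fun n => (contDiff_regAbs (by positivity)).continuous.comp_aestronglyMeasurable hφ.1)
    (Eventually.of_forall fun x => ?_)
    (fun n => diamagnetic_sobolev_regAbs h hφ hg (by positivity)) tendsto_const_nhds
  have hc : Continuous fun δ : ℝ => regAbs δ (φ x) := by
    unfold regAbs
    fun_prop
  have := (hc.tendsto 0).comp (tendsto_one_div_add_atTop_nhds_zero_nat (𝕜 := ℝ))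
  simpa [regAbs, comp_def] using this

/-! ### Orthogonality of gradients and divergence-free fields -/

instance holderTriple_three_six_two : ENNReal.HolderTriple 3 6 2 where
  inv_add_inv_eq_inv := by
    rw [← ENNReal.toReal_eq_toReal_iff' (by simp) (by simp),
      ENNReal.toReal_add (by simp) (by simp)]
    simp only [ENNReal.toReal_inv, ENNReal.toReal_ofNat]
    norm_num

instance holderTriple_six_three_two : ENNReal.HolderTriple 6 3 2 where
  inv_add_inv_eq_inv := by
    rw [add_comm]
    exact ENNReal.HolderTriple.inv_add_inv_eq_inv 3 6 2

instance holderTriple_six_six_three : ENNReal.HolderTriple 6 6 3 where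
  inv_add_inv_eq_inv := by
    rw [← ENNReal.toReal_eq_toReal_iff' (by simp) (by simp),
      ENNReal.toReal_add (by simp) (by simp)]
    simp only [ENNReal.toReal_inv, ENNReal.toReal_ofNat]
    norm_num

theorem eLpNorm_mul_le {p q r : ℝ≥0∞} [ENNReal.HolderTriple p q r] {u v : R3 → ℝ}
    (hu : AEStronglyMeasurable u volume) (hv : AEStronglyMeasurable v volume) :
    eLpNorm (fun x => u x * v x) r volume ≤ eLpNorm u p volume * eLpNorm v q volume :=
  eLpNorm_smul_le_mul_eLpNorm (φ := u) (f := v) hv hu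

/-- The gradients of the cutoffs are bounded in the scale-invariant space `L³`. -/
theorem exists_eLpNorm_fderiv_cutoff_le : ∃ M : ℝ≥0, ∀ n (v : R3), ‖v‖ ≤ 1 →
    eLpNorm (fun x => fderiv ℝ (cutoff n) x v) 3 volume ≤ M := by
  obtain ⟨M, hM⟩ := exists_norm_fderiv_cutoff_le
  have hvol : volume (Metric.closedBall (0 : R3) 1) ≠ ∞ := measure_closedBall_lt_top.ne
  set C : ℝ≥0∞ := 2 * M * volume (Metric.closedBall (0 : R3) 1) ^ (1 / (3 : ℝ)) with hC
  have hCtop : C ≠ ∞ := ENNReal.mul_ne_top (by finiteness)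
    (ENNReal.rpow_ne_top_of_nonneg (by norm_num) hvol)
  refine ⟨C.toNNReal, fun n v hv => ?_⟩
  rw [ENNReal.coe_toNNReal hCtop]
  set R : ℝ := (n : ℝ) + 1 with hR
  have hRpos : 0 < R := by positivity
  have hsupp : ∀ x : R3, 2 * R < ‖x‖ → fderiv ℝ (cutoff n) x = 0 := by
    intro x hx
    have : cutoff n =ᶠ[𝓝 x] fun _ => 0 := by
      filter_upwards [continuous_norm.continuousAt.eventually (lt_mem_nhds hx)] with z hz
      refine ContDiffBump.zero_of_le_dist _ ?_
      rw [dist_zero_right, norm_smul, norm_inv, Real.norm_of_nonneg hRpos.le]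
      change 2 ≤ R⁻¹ * ‖z‖
      rw [inv_mul_eq_div, le_div_iff₀ hRpos]
      exact hz.le
    rw [this.fderiv_eq]
    simp
  have hdom : ∀ x, ‖fderiv ℝ (cutoff n) x v‖
      ≤ ‖(Metric.closedBall (0 : R3) (2 * R)).indicator (fun _ => (M : ℝ) * R⁻¹) x‖ := by
    intro x
    by_cases hx : x ∈ Metric.closedBall (0 : R3) (2 * R)
    · rw [Set.indicator_of_mem hx, Real.norm_of_nonneg (by positivity : 0 ≤ (M : ℝ) * R⁻¹)]
      calc ‖fderiv ℝ (cutoff n) x v‖ ≤ ‖fderiv ℝ (cutoff n) x‖ * ‖v‖ :=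
            ContinuousLinearMap.le_opNorm _ _
        _ ≤ (M * R⁻¹) * 1 := by gcongr; exact hM n x
        _ = _ := mul_one _
    · rw [mem_closedBall_zero_iff, not_le] at hx
      rw [hsupp x hx]
      simp
  refine (eLpNorm_mono hdom).trans (le_of_eq ?_)
  rw [eLpNorm_indicator_const Metric.isClosed_closedBall.measurableSet (by norm_num) (by norm_num),
    Measure.addHaar_closedBall' volume _ (by positivity)]
  have h3 : (3 : ℝ≥0∞).toReal = 3 := by simp
  have hdim : Module.finrank ℝ R3 = 3 := by simp
  rw [h3, hdim, ENNReal.mul_rpow_of_nonneg _ _ (by norm_num),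
    ENNReal.ofReal_rpow_of_nonneg (by positivity) (by norm_num), ← Real.rpow_natCast,
    ← Real.rpow_mul (by positivity)]
  have e1 : ((3 : ℕ) : ℝ) * (1 / 3) = 1 := by norm_num
  have e2 : (M : ℝ) * R⁻¹ * (2 * R) = 2 * M := by field_simp
  rw [e1, Real.rpow_one, Real.enorm_of_nonneg (by positivity), ← mul_assoc,
    ← ENNReal.ofReal_mul (by positivity), e2, hC, ENNReal.ofReal_mul (by norm_num)]
  norm_num

theorem fderiv_cutoff_eq_zero {n : ℕ} {x : R3} (h : ‖x‖ < n + 1) : fderiv ℝ (cutoff n) x = 0 := by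
  have : cutoff n =ᶠ[𝓝 x] fun _ => 1 := by
    filter_upwards [continuous_norm.continuousAt.eventually (gt_mem_nhds h)] with z hz
    exact cutoff_eq_one (le_of_lt hz)
  rw [this.fderiv_eq]
  simp

/-- The Cauchy–Schwarz inequality. -/
theorem enorm_integral_mul_le {u v : R3 → ℝ} (hu : AEStronglyMeasurable u volume)
    (hv : AEStronglyMeasurable v volume) :
    ‖∫ x, u x * v x‖ₑ ≤ eLpNorm u 2 volume * eLpNorm v 2 volume := by
  refine (enorm_integral_le_lintegral_enorm _).trans ?_
  rw [← eLpNorm_one_eq_lintegral_enorm]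
  exact eLpNorm_mul_le (p := 2) (q := 2) hu hv

theorem integral_sum_mul {u v : Fin 3 → R3 → ℝ} (hu : ∀ j, MemLp (u j) 2 volume)
    (hv : ∀ j, MemLp (v j) 2 volume) :
    ∫ x, ∑ j, u j x * v j x = ∑ j, ∫ x, u j x * v j x :=
  integral_finsetSum _ fun j _ => (hu j).integrable_mul (hv j)

/-- If `u` is the limit in `L²` of fields orthogonal to `v`, it is orthogonal to `v`. -/
theorem integral_sum_mul_eq_zero_of_tendsto {u v : Fin 3 → R3 → ℝ} {w : ℕ → Fin 3 → R3 → ℝ}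
    (hu : ∀ j, MemLp (u j) 2 volume) (hv : ∀ j, MemLp (v j) 2 volume)
    (hw : ∀ n j, MemLp (w n j) 2 volume) (h0 : ∀ n, ∫ x, ∑ j, w n j x * v j x = 0)
    (hlim : ∀ j, Tendsto (fun n => ‖∫ x, (u j x - w n j x) * v j x‖ₑ) atTop (𝓝 0)) :
    ∫ x, ∑ j, u j x * v j x = 0 := by
  rw [← enorm_eq_zero, ← nonpos_iff_eq_zero]
  have hsum := tendsto_finsetSum Finset.univ fun j _ => hlim j
  rw [Finset.sum_const_zero] at hsum
  refine ge_of_tendsto' hsum fun n => ?_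
  have e : ∫ x, ∑ j, u j x * v j x = ∑ j, ∫ x, (u j x - w n j x) * v j x := by
    rw [← sub_zero (∫ x, ∑ j, u j x * v j x), ← h0 n, integral_sum_mul hu hv,
      integral_sum_mul (hw n) hv, ← Finset.sum_sub_distrib]
    refine Finset.sum_congr rfl fun j _ => ?_
    simp only [sub_mul]
    exact (integral_sub ((hu j).integrable_mul (hv j)) ((hw n j).integrable_mul (hv j))).symm
  rw [e]
  exact enorm_sum_le _ _

/-- The divergence-free condition, tested against the functions `cutoff n * h`. The term that
contains the gradient of the cutoff is at most `‖h‖_6 ‖∇ cutoff n‖_3 ‖V‖_{L²(|x| ≥ n + 1)}`, which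
tends to zero. -/
theorem integral_fderiv_mul_eq_zero {h : R3 → ℝ} {V : Fin 3 → R3 → ℝ}
    (hh : ContDiff ℝ ((⊤ : ℕ∞) : WithTop ℕ∞) h) (h6 : MemLp h 6 volume)
    (hd : ∀ j : Fin 3, MemLp (fun x => fderiv ℝ h x (EuclideanSpace.single j 1)) 2 volume)
    (hV : ∀ j, MemLp (V j) 2 volume) (hdiv : IsDivergenceFree V) :
    ∫ x, ∑ j : Fin 3, fderiv ℝ h x (EuclideanSpace.single j 1) * V j x = 0 := by
  obtain ⟨M, hM⟩ := exists_eLpNorm_fderiv_cutoff_le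
  have hh1 : Differentiable ℝ h := hh.differentiable (by simp)
  have hc1 : ∀ n, Differentiable ℝ (cutoff n) :=
    fun n => (contDiff_cutoff n (m := ⊤)).differentiable (by simp)
  have hcfd : ∀ n (v : R3), Continuous fun x => fderiv ℝ (cutoff n) x v := fun n v =>
    ((contDiff_cutoff n (m := ⊤)).continuous_fderiv (by simp)).clm_apply continuous_const
  have hcc : ∀ n, Continuous (cutoff n) := fun n => (contDiff_cutoff n (m := 0)).continuous
  have hprod : ∀ n x v, fderiv ℝ (fun x => cutoff n x * h x) x v
      = cutoff n x * fderiv ℝ h x v + h x * fderiv ℝ (cutoff n) x v := by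
    intro n x v
    rw [fderiv_fun_mul (hc1 n x) (hh1 x)]
    simp
  have hP : ∀ n (j : Fin 3), MemLp
      (fun x => cutoff n x * fderiv ℝ h x (EuclideanSpace.single j 1)) 2 volume := fun n j =>
    (hd j).mono ((hcc n).aestronglyMeasurable.mul (hd j).1) (Eventually.of_forall fun x => by
      rw [norm_mul]
      exact mul_le_of_le_one_left (norm_nonneg _) (norm_cutoff_le_one n x))
  have hQb : ∀ n (j : Fin 3), eLpNorm
      (fun x => h x * fderiv ℝ (cutoff n) x (EuclideanSpace.single j 1)) 2 volume
      ≤ eLpNorm h 6 volume * M := fun n j =>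
    (eLpNorm_mul_le (p := 6) (q := 3) h6.1 (hcfd n _).aestronglyMeasurable).trans
      (mul_le_mul_right (hM n _ (by simp)) _)
  have hQ : ∀ n (j : Fin 3), MemLp
      (fun x => h x * fderiv ℝ (cutoff n) x (EuclideanSpace.single j 1)) 2 volume := fun n j =>
    ⟨h6.1.mul (hcfd n _).aestronglyMeasurable,
      (hQb n j).trans_lt (ENNReal.mul_lt_top h6.2 ENNReal.coe_lt_top)⟩
  refine integral_sum_mul_eq_zero_of_tendsto
    (w := fun n j x => fderiv ℝ (fun x => cutoff n x * h x) x (EuclideanSpace.single j 1))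
    hd hV (fun n j => ?_) (fun n => ?_) (fun j => ?_)
  · simp only [hprod]
    exact (hP n j).add (hQ n j)
  · exact hdiv _ ((contDiff_cutoff n).mul hh) ((hasCompactSupport_cutoff n).mul_right)
  · set d : R3 → ℝ := fun x => fderiv ℝ h x (EuclideanSpace.single j 1) with hddef
    set q : ℕ → R3 → ℝ := fun n x => fderiv ℝ (cutoff n) x (EuclideanSpace.single j 1) with hqdef
    -- On the support of the gradient of the cutoff, `V` may be replaced by its tail.
    set T : ℕ → R3 → ℝ := fun n => {x : R3 | (n : ℝ) + 1 ≤ ‖x‖}.indicator (V j) with hT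
    have hTm : ∀ n, AEStronglyMeasurable (T n) volume := fun n =>
      (hV j).1.indicator (measurableSet_le measurable_const measurable_norm)
    have hev : ∀ x : R3, ∀ᶠ n : ℕ in atTop, ‖x‖ < (n : ℝ) + 1 := fun x => by
      filter_upwards [eventually_ge_atTop ⌈‖x‖⌉₊] with n hn
      have h1 : (⌈‖x‖⌉₊ : ℝ) ≤ n := by exact_mod_cast hn
      linarith [Nat.le_ceil ‖x‖]
    have hT0 : Tendsto (fun n => eLpNorm (T n) 2 volume) atTop (𝓝 0) := by
      have := tendsto_eLpNorm_of_dominated (v := fun _ => 0) hTm (hV j)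
        (fun n x => norm_indicator_le_norm_self _ _) (Eventually.of_forall fun x =>
          tendsto_const_nhds.congr' ((hev x).mono fun n hn => by
            rw [hT]
            exact (Set.indicator_of_notMem (by simpa using hn) _).symm))
      simpa using this
    have hR0 : Tendsto (fun n => eLpNorm (fun x => (1 - cutoff n x) * d x) 2 volume) atTop
        (𝓝 0) := by
      have := tendsto_eLpNorm_of_dominated (u := fun n x => (1 - cutoff n x) * d x)
        (v := fun _ => 0) (fun n => (aestronglyMeasurable_const.sub
          (hcc n).aestronglyMeasurable).mul (hd j).1) (hd j)
        (fun n x => ?_) (Eventually.of_forall fun x =>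
          tendsto_const_nhds.congr' ((eventually_cutoff_eq_one x).mono fun n hn => by simp [hn]))
      · simpa using this
      · rw [norm_mul]
        refine mul_le_of_le_one_left (norm_nonneg _) ?_
        have h0 : 0 ≤ cutoff n x := ContDiffBump.nonneg _
        have h1 : cutoff n x ≤ 1 := ContDiffBump.le_one _
        rw [Real.norm_eq_abs, abs_le]
        constructor <;> linarith
    have hb : ∀ n, ‖∫ x, (d x - fderiv ℝ (fun x => cutoff n x * h x) x
        (EuclideanSpace.single j 1)) * V j x‖ₑ
        ≤ eLpNorm (fun x => (1 - cutoff n x) * d x) 2 volume * eLpNorm (V j) 2 volume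
          + eLpNorm h 6 volume * M * eLpNorm (T n) 2 volume := by
      intro n
      have hR : MemLp (fun x => (1 - cutoff n x) * d x) 2 volume := by
        have := (hd j).sub (hP n j)
        refine this.ae_eq (Eventually.of_forall fun x => ?_)
        simp only [Pi.sub_apply, hddef]
        ring
      have hTn : MemLp (T n) 2 volume :=
        (hV j).indicator (measurableSet_le measurable_const measurable_norm)
      have e : ∀ x, (d x - fderiv ℝ (fun x => cutoff n x * h x) x
          (EuclideanSpace.single j 1)) * V j x
          = (1 - cutoff n x) * d x * V j x - h x * q n x * T n x := by
        intro x
        rw [hprod]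
        by_cases hx : (n : ℝ) + 1 ≤ ‖x‖
        · have : T n x = V j x := Set.indicator_of_mem (s := {x : R3 | (n : ℝ) + 1 ≤ ‖x‖}) hx _
          rw [this, hddef, hqdef]
          ring
        · have : q n x = 0 := by
            rw [hqdef]
            simp only
            rw [fderiv_cutoff_eq_zero (not_le.1 hx)]
            simp
          rw [this]
          rw [hqdef] at this
          simp only at this
          rw [this, hddef]
          ring
      simp only [e]
      have e' : ∫ x, ((1 - cutoff n x) * d x * V j x - h x * q n x * T n x)
          = (∫ x, (1 - cutoff n x) * d x * V j x) - ∫ x, h x * q n x * T n x :=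
        integral_sub (hR.integrable_mul (hV j)) ((hQ n j).integrable_mul hTn)
      rw [e']
      refine enorm_sub_le.trans (add_le_add (enorm_integral_mul_le hR.1 (hV j).1)
        ((enorm_integral_mul_le (hQ n j).1 hTn.1).trans ?_))
      gcongr
      exact hQb n j
    have hlim0 := (ENNReal.Tendsto.mul_const hR0 (Or.inr (hV j).2.ne)).add
      (ENNReal.Tendsto.const_mul hT0
        (Or.inr (ENNReal.mul_ne_top h6.2.ne (ENNReal.coe_ne_top (r := M)))))
    simp only [zero_mul, mul_zero, add_zero] at hlim0
    exact tendsto_of_tendsto_of_tendsto_of_le_of_le tendsto_const_nhds hlim0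
      (fun _ => zero_le) hb

/-- In `L²(ℝ³)`, gradients of functions in `L⁶` are orthogonal to divergence-free fields. -/
theorem integral_weakGradient_mul_eq_zero {f : R3 → ℝ} {g V : Fin 3 → R3 → ℝ}
    (h : ∀ j, HasWeakPartial j f (g j)) (hg : ∀ j, MemLp (g j) 2 volume) (h6 : MemLp f 6 volume)
    (hV : ∀ j, MemLp (V j) 2 volume) (hdiv : IsDivergenceFree V) :
    ∫ x, ∑ j, g j x * V j x = 0 := by
  have hf := (h 0).locallyIntegrable
  refine integral_sum_mul_eq_zero_of_tendsto (w := fun n j => mollify n (g j)) hg hV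
    (fun n j => memLp_mollify one_le_two ENNReal.ofNat_ne_top (hg j) n) (fun n => ?_) (fun j => ?_)
  · have := integral_fderiv_mul_eq_zero (contDiff_mollify hf n ⊤)
      (memLp_mollify (by norm_num) ENNReal.ofNat_ne_top h6 n) (fun j => ?_) hV hdiv
    · simpa only [fderiv_mollify (h _)] using this
    · simp only [fderiv_mollify (h j)]
      exact memLp_mollify one_le_two ENNReal.ofNat_ne_top (hg j) n
  · have h0 := ENNReal.Tendsto.mul_const (tendsto_eLpNorm_sub_mollify one_le_two
      ENNReal.ofNat_ne_top (hg j)) (Or.inr (hV j).2.ne)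
    rw [zero_mul] at h0
    exact tendsto_of_tendsto_of_tendsto_of_le_of_le tendsto_const_nhds h0 (fun _ => zero_le)
      fun n => enorm_integral_mul_le
        ((hg j).1.sub (memLp_mollify one_le_two ENNReal.ofNat_ne_top (hg j) n).1) (hV j).1

/-! ### Bounds from the Hamiltonian -/

theorem eLpNorm_two_le_sqrt {F : Type*} [NormedAddCommGroup F] {f : R3 → F} {L : ℝ≥0}
    (h : ∫⁻ x, ENNReal.ofReal (‖f x‖ ^ 2) ≤ L) : eLpNorm f 2 volume ≤ NNReal.sqrt L := by
  rw [eLpNorm_eq_lintegral_rpow_enorm_toReal two_ne_zero ENNReal.ofNat_ne_top,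
    NNReal.sqrt_eq_rpow, ENNReal.coe_rpow_of_nonneg _ (by norm_num), ENNReal.toReal_ofNat]
  refine ENNReal.rpow_le_rpow (le_trans (le_of_eq (lintegral_congr fun x => ?_)) h) (by norm_num)
  rw [← ofReal_norm, ENNReal.ofReal_rpow_of_nonneg (norm_nonneg _) (by norm_num)]
  norm_num

/-- If `g ⟂ V` in `L²`, then `‖g - V‖² = ‖g‖² + ‖V‖²` controls the norms of `g` and of `V`. -/
theorem eLpNorm_le_of_orthogonal {g V : Fin 3 → R3 → ℝ} (hg : ∀ j, MemLp (g j) 2 volume)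
    (hV : ∀ j, MemLp (V j) 2 volume) (h0 : ∫ x, ∑ j, g j x * V j x = 0) {L : ℝ≥0}
    (hL : ∫⁻ x, ENNReal.ofReal (∑ j, (g j x - V j x) ^ 2) ≤ L) (k : Fin 3) :
    eLpNorm (g k) 2 volume ≤ NNReal.sqrt L ∧ eLpNorm (V k) 2 volume ≤ NNReal.sqrt L := by
  have hgi : Integrable (fun x => ∑ j, g j x ^ 2) volume :=
    integrable_finsetSum _ fun j _ => (hg j).integrable_sq
  have hVi : Integrable (fun x => ∑ j, V j x ^ 2) volume :=
    integrable_finsetSum _ fun j _ => (hV j).integrable_sq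
  have hgV : Integrable (fun x => ∑ j, g j x * V j x) volume :=
    integrable_finsetSum _ fun j _ => (hg j).integrable_mul (hV j)
  have hdi : Integrable (fun x => ∑ j, (g j x - V j x) ^ 2) volume :=
    integrable_finsetSum _ fun j _ => ((hg j).sub (hV j)).integrable_sq
  have hsplit : ∫ x, ∑ j, (g j x - V j x) ^ 2
      = (∫ x, ∑ j, g j x ^ 2) + ∫ x, ∑ j, V j x ^ 2 := by
    have e : ∀ x, ∑ j, (g j x - V j x) ^ 2
        = (∑ j, g j x ^ 2 + ∑ j, V j x ^ 2) - 2 * ∑ j, g j x * V j x := by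
      intro x
      rw [Finset.mul_sum, ← Finset.sum_add_distrib, ← Finset.sum_sub_distrib]
      exact Finset.sum_congr rfl fun j _ => by ring
    simp only [e]
    refine (integral_sub (hgi.add hVi) (hgV.const_mul 2)).trans ?_
    rw [integral_const_mul, h0, mul_zero, sub_zero]
    exact integral_add hgi hVi
  have hLr : ENNReal.ofReal (∫ x, ∑ j, (g j x - V j x) ^ 2) ≤ L := by
    rw [ofReal_integral_eq_lintegral_ofReal hdi
      (Eventually.of_forall fun x => Finset.sum_nonneg fun j _ => sq_nonneg _)]
    exact hL
  have key : ∀ u : Fin 3 → R3 → ℝ, (∀ j, MemLp (u j) 2 volume) →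
      (∫ x, ∑ j, u j x ^ 2) ≤ ∫ x, ∑ j, (g j x - V j x) ^ 2 →
      eLpNorm (u k) 2 volume ≤ NNReal.sqrt L := by
    intro u hu hle
    refine eLpNorm_two_le_sqrt (le_trans ?_ hLr)
    simp only [Real.norm_eq_abs, sq_abs]
    rw [← ofReal_integral_eq_lintegral_ofReal (hu k).integrable_sq
      (Eventually.of_forall fun x => sq_nonneg _)]
    refine ENNReal.ofReal_le_ofReal (le_trans ?_ hle)
    refine integral_mono (hu k).integrable_sq
      (integrable_finsetSum _ fun j _ => (hu j).integrable_sq) fun x => ?_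
    exact Finset.single_le_sum (f := fun j => u j x ^ 2) (fun j _ => sq_nonneg _)
      (Finset.mem_univ k)
  have hg0 : 0 ≤ ∫ x, ∑ j, g j x ^ 2 :=
    integral_nonneg fun x => Finset.sum_nonneg fun j _ => sq_nonneg _
  have hV0 : 0 ≤ ∫ x, ∑ j, V j x ^ 2 :=
    integral_nonneg fun x => Finset.sum_nonneg fun j _ => sq_nonneg _
  exact ⟨key g hg (by linarith), key V hV (by linarith)⟩

/-- Weak partial derivatives of a divergence-free field are divergence-free, by the symmetry of the
second derivatives of the test function. -/
theorem IsDivergenceFree.weakPartial {A B : Fin 3 → R3 → ℝ} (hdiv : IsDivergenceFree A)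
    (hA : ∀ k, MemLp (A k) 2 volume) (hB : ∀ k, MemLp (B k) 2 volume) {j : Fin 3}
    (h : ∀ k, HasWeakPartial j (A k) (B k)) : IsDivergenceFree B := by
  intro ψ hψ hc
  have hψ' : ContDiff ℝ ((⊤ : ℕ∞) : WithTop ℕ∞) (fderiv ℝ ψ) :=
    hψ.fderiv_right (by simp)
  have hsm : ∀ k : Fin 3, ContDiff ℝ ((⊤ : ℕ∞) : WithTop ℕ∞)
      fun x => fderiv ℝ ψ x (EuclideanSpace.single k 1) := fun k => hψ'.clm_apply contDiff_const
  have hcs : ∀ k : Fin 3, HasCompactSupport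
      fun x => fderiv ℝ ψ x (EuclideanSpace.single k 1) := fun k =>
    hc.fderiv_apply ℝ _
  have hmem : ∀ k l : Fin 3, MemLp (fun x => fderiv ℝ (fun x => fderiv ℝ ψ x
      (EuclideanSpace.single k 1)) x (EuclideanSpace.single l 1)) 2 volume := fun k l =>
    (((hsm k).continuous_fderiv (by simp)).clm_apply continuous_const).memLp_of_hasCompactSupport
      ((hcs k).fderiv_apply ℝ _)
  have hsymm : ∀ (k : Fin 3) x, fderiv ℝ (fun x => fderiv ℝ ψ x (EuclideanSpace.single k 1)) x
      (EuclideanSpace.single j 1) = fderiv ℝ (fun x => fderiv ℝ ψ x (EuclideanSpace.single j 1)) x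
      (EuclideanSpace.single k 1) := by
    intro k x
    have hd : ∀ v : R3, fderiv ℝ (fun x => fderiv ℝ ψ x v) x
        = (fderiv ℝ (fderiv ℝ ψ) x).flip v := by
      intro v
      ext w
      rw [fderiv_clm_apply ((hψ'.differentiable (by simp)) x) (differentiableAt_const v)]
      simp
    rw [hd, hd]
    have h2 : minSmoothness ℝ 2 ≤ ((⊤ : ℕ∞) : WithTop ℕ∞) := by
      rw [minSmoothness_of_isRCLikeNormedField]
      exact WithTop.coe_le_coe.2 (le_top : (2 : ℕ∞) ≤ ⊤)
    exact (hψ.contDiffAt.isSymmSndFDerivAt h2) _ _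
  have hψ2 : ∀ k : Fin 3, MemLp (fun x => fderiv ℝ ψ x (EuclideanSpace.single k 1)) 2 volume :=
    fun k => (hsm k).continuous.memLp_of_hasCompactSupport (hcs k)
  have h0 := hdiv _ (hsm j) (hcs j)
  rw [integral_sum_mul (fun k => hmem j k) hA] at h0
  rw [integral_sum_mul hψ2 hB, ← neg_eq_zero, ← Finset.sum_neg_distrib, ← h0]
  refine Finset.sum_congr rfl fun k _ => ?_
  have := (h k).integral_eq _ (hsm k) (hcs k)
  simp only [smul_eq_mul] at this
  rw [← this]
  simp only [hsymm]

/-- For a divergence-free field in `H¹`, the curl controls the whole gradient in `L²`: pointwise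
`|∇ × A|² = |∇A|² - ∑ ∂_k A_j ∂_j A_k`, and for each `j` the sum over `k` of the cross terms pairs
the gradient of `A_j` with the divergence-free field `∂_j A`. -/
theorem eLpNorm_weakPartial_le_of_curl {A : Fin 3 → R3 → ℝ} (hA : ∀ k, MemH1 (A k))
    (h6 : ∀ k, MemLp (A k) 6 volume)
    (hdiv : IsDivergenceFree A) (h : ∀ j k, HasWeakPartial j (A k) (weakPartial j (A k)))
    (hB : ∀ j k, MemLp (weakPartial j (A k)) 2 volume) {L : ℝ≥0}
    (hL : ∫⁻ x, ENNReal.ofReal (∑ j, curl A j x ^ 2) ≤ L) (j k : Fin 3) :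
    eLpNorm (weakPartial j (A k)) 2 volume ≤ NNReal.sqrt L := by
  set B : Fin 3 → Fin 3 → R3 → ℝ := fun j k => MKG.weakPartial j (A k) with hBdef
  have hcross : ∀ j, ∫ x, ∑ k, B k j x * B j k x = 0 := fun j =>
    integral_weakGradient_mul_eq_zero (fun k => h k j) (fun k => hB k j) (h6 j)
      (fun k => hB j k) (hdiv.weakPartial (fun k => (hA k).1) (fun k => hB j k) (h j))
  have hsq : Integrable (fun x => ∑ j, ∑ k, B j k x ^ 2) volume :=
    integrable_finsetSum _ fun j _ => integrable_finsetSum _ fun k _ => (hB j k).integrable_sq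
  have hcr : ∀ j, Integrable (fun x => ∑ k, B k j x * B j k x) volume := fun j =>
    integrable_finsetSum _ fun k _ => (hB k j).integrable_mul (hB j k)
  have hpt : ∀ x, ∑ j, curl A j x ^ 2
      = (∑ j, ∑ k, B j k x ^ 2) - ∑ j, ∑ k, B k j x * B j k x := by
    intro x
    have e : ∀ j, curl A j x = B (j + 1) (j + 2) x - B (j + 2) (j + 1) x := fun j => rfl
    simp only [e, Fin.sum_univ_three]
    simp only [show (0 : Fin 3) + 1 = 1 from rfl, show (0 : Fin 3) + 2 = 2 from rfl,
      show (1 : Fin 3) + 1 = 2 from rfl, show (1 : Fin 3) + 2 = 0 from rfl,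
      show (2 : Fin 3) + 1 = 0 from rfl, show (2 : Fin 3) + 2 = 1 from rfl]
    ring
  have hint : ∫ x, ∑ j, curl A j x ^ 2 = ∫ x, ∑ j, ∑ k, B j k x ^ 2 := by
    simp only [hpt]
    rw [integral_sub hsq (integrable_finsetSum _ fun j _ => hcr j),
      integral_finsetSum _ fun j _ => hcr j]
    simp only [hcross, Finset.sum_const_zero, sub_zero]
  have hci : Integrable (fun x => ∑ j, curl A j x ^ 2) volume := by
    simp only [hpt]
    exact hsq.sub (integrable_finsetSum _ fun j _ => hcr j)
  refine eLpNorm_two_le_sqrt (le_trans ?_ hL)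
  simp only [Real.norm_eq_abs, sq_abs]
  rw [← ofReal_integral_eq_lintegral_ofReal (hB j k).integrable_sq
      (Eventually.of_forall fun x => sq_nonneg _),
    ← ofReal_integral_eq_lintegral_ofReal hci
      (Eventually.of_forall fun x => Finset.sum_nonneg fun j _ => sq_nonneg _), hint]
  refine ENNReal.ofReal_le_ofReal (integral_mono (hB j k).integrable_sq hsq fun x => ?_)
  refine (Finset.single_le_sum (f := fun k => B j k x ^ 2) (fun k _ => sq_nonneg _)
    (Finset.mem_univ k)).trans ?_
  exact Finset.single_le_sum (f := fun j => ∑ k, B j k x ^ 2)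
    (fun j _ => Finset.sum_nonneg fun k _ => sq_nonneg _) (Finset.mem_univ j)

theorem HasL2Gradient.hasWeakPartial {F : Type*} [NormedAddCommGroup F] [NormedSpace ℝ F]
    {f : R3 → F} (h : HasL2Gradient f) (j : Fin 3) : HasWeakPartial j f (weakPartial j f) := by
  obtain ⟨g, hg, -⟩ := h j
  exact hasWeakPartial_weakPartial ⟨g, hg⟩

/-- Weak partial derivatives are unique almost everywhere. -/
theorem HasWeakPartial.ae_eq {F : Type*} [NormedAddCommGroup F] [NormedSpace ℝ F]
    [CompleteSpace F] {f g g' : R3 → F} {j : Fin 3} (h : HasWeakPartial j f g)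
    (h' : HasWeakPartial j f g') : g =ᵐ[volume] g' :=
  ae_eq_of_integral_contDiff_smul_eq h.locallyIntegrable_deriv h'.locallyIntegrable_deriv
    fun ψ hψ hc => by
      rw [← neg_inj, ← h.integral_eq ψ hψ hc, h'.integral_eq ψ hψ hc]

theorem HasL2Gradient.memLp_weakPartial {F : Type*} [NormedAddCommGroup F] [NormedSpace ℝ F]
    [CompleteSpace F] {f : R3 → F} (h : HasL2Gradient f) (j : Fin 3) :
    MemLp (weakPartial j f) 2 volume := by
  obtain ⟨g, hg, hg2⟩ := h j
  exact hg2.ae_eq (hg.ae_eq (h.hasWeakPartial j))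

/-- A common bound `C` for the energy components of the fields: the gradients, time derivatives and
covariant derivatives in `L²`, and the potentials and `φ` in `L⁶`. -/
structure EnergyBounds (C : ℝ≥0) (A0 : R3 → ℝ) (A At : Fin 3 → R3 → ℝ) (φ φt : R3 → ℂ) :
    Prop where
  gradA0 : ∀ j, eLpNorm (weakPartial j A0) 2 volume ≤ C
  gradA : ∀ j k, eLpNorm (weakPartial j (A k)) 2 volume ≤ C
  At : ∀ k, eLpNorm (At k) 2 volume ≤ C
  covTime : eLpNorm (covTime A0 φ φt) 2 volume ≤ C
  covSpace : ∀ j, eLpNorm (covSpace A φ j) 2 volume ≤ C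
  A0 : eLpNorm A0 6 volume ≤ C
  A : ∀ k, eLpNorm (A k) 6 volume ≤ C
  φ : eLpNorm φ 6 volume ≤ C

theorem lintegral_le_of_half_le {Q : R3 → ℝ} {G : R3 → ℝ} (h : ∀ x, 1 / 2 * Q x ≤ G x) {K : ℝ≥0}
    (hK : ∫⁻ x, ENNReal.ofReal (G x) ≤ K) :
    ∫⁻ x, ENNReal.ofReal (Q x) ≤ (2 * K : ℝ≥0) := by
  have e : ∀ x, ENNReal.ofReal (Q x) ≤ 2 * ENNReal.ofReal (G x) := by
    intro x
    rw [← ENNReal.ofReal_ofNat 2, ← ENNReal.ofReal_mul (by norm_num)]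
    exact ENNReal.ofReal_le_ofReal (by linarith [h x])
  refine (lintegral_mono e).trans ?_
  rw [lintegral_const_mul' _ _ ENNReal.ofNat_ne_top, ENNReal.coe_mul]
  gcongr
  simp

/-- The Hamiltonian provides energy bounds that depend on its value only. -/
theorem exists_energyBounds (K : ℝ≥0) :
    ∃ C : ℝ≥0, ∀ (A0 : R3 → ℝ) (A At : Fin 3 → R3 → ℝ) (φ φt : R3 → ℂ),
      IsEnergyClass A0 A At φ φt → IsDivergenceFree A → IsDivergenceFree At →
      hamiltonian A0 A At φ φt ≤ K → EnergyBounds C A0 A At φ φt := by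
  obtain ⟨S, hS⟩ := exists_sobolev_weak
  set c : ℝ≥0 := NNReal.sqrt (2 * K) with hc
  refine ⟨c + S * (3 * c) + sobolevConst * (3 * c), fun A0 A At φ φt hE hdA hdAt hH => ?_⟩
  set C : ℝ≥0 := c + S * (3 * c) + sobolevConst * (3 * c) with hC
  have hc1 : (c : ℝ≥0∞) ≤ C := by
    rw [ENNReal.coe_le_coe, hC, add_assoc]
    exact le_self_add
  have hc2 : ((S * (3 * c) : ℝ≥0) : ℝ≥0∞) ≤ C := by
    rw [ENNReal.coe_le_coe, hC]
    exact le_add_self.trans le_self_add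
  have hc3 : ((sobolevConst * (3 * c) : ℝ≥0) : ℝ≥0∞) ≤ C := by
    rw [ENNReal.coe_le_coe, hC]
    exact le_add_self
  have hsum : ∀ {u : Fin 3 → ℝ≥0∞} {S : ℝ≥0}, (∀ j, u j ≤ c) →
      (S : ℝ≥0∞) * ∑ j, u j ≤ (S * (3 * c) : ℝ≥0) := by
    intro u S hu
    rw [ENNReal.coe_mul, ENNReal.coe_mul]
    gcongr
    refine (Finset.sum_le_sum fun j _ => hu j).trans (le_of_eq ?_)
    simp
  have n1 : ∀ x, 0 ≤ ∑ j : Fin 3, (weakPartial j A0 x - At j x) ^ 2 := fun x =>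
    Finset.sum_nonneg fun j _ => sq_nonneg _
  have n2 : ∀ x, 0 ≤ ∑ j : Fin 3, curl A j x ^ 2 := fun x =>
    Finset.sum_nonneg fun j _ => sq_nonneg _
  have n3 : ∀ x, 0 ≤ ‖covTime A0 φ φt x‖ ^ 2 := fun x => sq_nonneg _
  have n4 : ∀ x, 0 ≤ ∑ j : Fin 3, ‖covSpace A φ j x‖ ^ 2 := fun x =>
    Finset.sum_nonneg fun j _ => sq_nonneg _
  have hgA0 := hE.memA0.1.memLp_weakPartial
  have hwA0 := hE.memA0.1.hasWeakPartial
  have hgA := fun k => (hE.memA k).2.memLp_weakPartial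
  have hwA := fun k => (hE.memA k).2.hasWeakPartial
  have hA6 : ∀ k, eLpNorm (A k) 6 volume
      ≤ S * ∑ j, eLpNorm (weakPartial j (A k)) 2 volume := fun k =>
    hS _ _ (hwA k) (hgA k) (vanishesAtInfinity_of_memLp (hE.memA k).1)
  have hA06 : eLpNorm A0 6 volume ≤ S * ∑ j, eLpNorm (weakPartial j A0) 2 volume :=
    hS _ _ hwA0 hgA0 hE.memA0.2
  have hA0mem : MemLp A0 6 volume :=
    ⟨(hwA0 0).locallyIntegrable.aestronglyMeasurable, hA06.trans_lt (ENNReal.mul_lt_top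
      ENNReal.coe_lt_top (ENNReal.sum_lt_top.2 fun j _ => (hgA0 j).2))⟩
  have hAmem : ∀ k, MemLp (A k) 6 volume := fun k =>
    ⟨(hE.memA k).1.1, (hA6 k).trans_lt (ENNReal.mul_lt_top
      ENNReal.coe_lt_top (ENNReal.sum_lt_top.2 fun j _ => (hgA k j).2))⟩
  have b1 := eLpNorm_le_of_orthogonal hgA0 hE.memAt
    (integral_weakGradient_mul_eq_zero hwA0 hgA0 hA0mem hE.memAt hdAt)
    (lintegral_le_of_half_le (fun x => by linarith [n1 x, n2 x, n3 x, n4 x]) hH)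
  have b2 := eLpNorm_weakPartial_le_of_curl hE.memA hAmem hdA (fun j k => hwA k j)
    (fun j k => hgA k j)
    (lintegral_le_of_half_le (fun x => by linarith [n1 x, n2 x, n3 x, n4 x]) hH)
  have b3 : eLpNorm (covTime A0 φ φt) 2 volume ≤ c := eLpNorm_two_le_sqrt
    (lintegral_le_of_half_le (fun x => by linarith [n1 x, n2 x, n3 x, n4 x]) hH)
  have b4 : ∀ j, eLpNorm (covSpace A φ j) 2 volume ≤ c := fun j => eLpNorm_two_le_sqrt
    (lintegral_le_of_half_le (fun x => by
      have := Finset.single_le_sum (f := fun j => ‖covSpace A φ j x‖ ^ 2)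
        (fun j _ => sq_nonneg _) (Finset.mem_univ j)
      linarith [n1 x, n2 x, n3 x, n4 x]) hH)
  exact
    { gradA0 := fun j => (b1 j).1.trans hc1
      gradA := fun j k => (b2 j k).trans hc1
      At := fun k => (b1 k).2.trans hc1
      covTime := b3.trans hc1
      covSpace := fun j => (b4 j).trans hc1
      A0 := (hA06.trans (hsum fun j => (b1 j).1)).trans hc2
      A := fun k => ((hA6 k).trans (hsum fun j => b2 j k)).trans hc2
      φ := ((diamagnetic_sobolev hE.memφ.2.hasWeakPartial hE.memφ.1
        hE.memφ.2.memLp_weakPartial).trans (hsum b4)).trans hc3 }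

/-! ### Averages of functions with weak derivatives -/

section

variable {F : Type*} [NormedAddCommGroup F]

/-- Absolute convergence of `∫ u(x) κ(y) f(x - y) dx dy` for bounded integrable `u` and
`f ∈ L^p`. -/
theorem lintegral_mul_lintegral_translate_lt_top {κ : R3 → ℝ} {f : R3 → F} {p : ℝ≥0∞}
    (hp : 1 ≤ p) (hp' : p ≠ ∞) (hκ : Continuous κ) (hκ' : Integrable κ volume)
    (hf : MemLp f p volume) {E : Type*} [NormedAddCommGroup E] {u : R3 → E}
    (hu : Integrable u volume) {M : ℝ≥0} (hM : ∀ x, ‖u x‖ₑ ≤ M) :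
    ∫⁻ x, ‖u x‖ₑ * ∫⁻ y, ‖κ y‖ₑ * ‖f (x - y)‖ₑ < ∞ := by
  have hp0 : p ≠ 0 := (zero_lt_one.trans_le hp).ne'
  have hr : 1 ≤ p.toReal := by
    simpa using (ENNReal.toReal_le_toReal ENNReal.one_ne_top hp').2 hp
  set G : R3 → ℝ≥0∞ := fun x => ∫⁻ y, ‖κ y‖ₑ * ‖f (x - y)‖ₑ with hG
  have h1 : eLpNorm G p volume < ∞ :=
    (eLpNorm_lintegral_translate_le hp hp' hκ hκ' hf.1).trans_lt (ENNReal.mul_lt_top hκ'.2 hf.2)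
  rw [eLpNorm_lt_top_iff_lintegral_rpow_enorm_lt_top hp0 hp'] at h1
  have hle : ∀ t : ℝ≥0∞, t ≤ 1 + t ^ p.toReal := by
    intro t
    rcases le_total t 1 with ht | ht
    · exact ht.trans le_self_add
    · calc t = t ^ (1 : ℝ) := (ENNReal.rpow_one t).symm
        _ ≤ t ^ p.toReal := ENNReal.rpow_le_rpow_of_exponent_le ht hr
        _ ≤ _ := le_add_self
  calc ∫⁻ x, ‖u x‖ₑ * G x ≤ ∫⁻ x, (‖u x‖ₑ + M * ‖G x‖ₑ ^ p.toReal) := by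
        refine lintegral_mono fun x => ?_
        calc ‖u x‖ₑ * G x ≤ ‖u x‖ₑ * (1 + G x ^ p.toReal) := by gcongr; exact hle _
          _ = ‖u x‖ₑ + ‖u x‖ₑ * G x ^ p.toReal := by rw [mul_add, mul_one]
          _ ≤ _ := by rw [enorm_eq_self]; gcongr; exact hM x
    _ = (∫⁻ x, ‖u x‖ₑ) + M * ∫⁻ x, ‖G x‖ₑ ^ p.toReal := by
        rw [lintegral_add_left' hu.1.enorm, lintegral_const_mul' _ _ ENNReal.coe_ne_top]
    _ < ∞ := ENNReal.add_lt_top.2 ⟨hu.2, ENNReal.mul_lt_top ENNReal.coe_lt_top h1⟩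

end

section

variable {F : Type*} [NormedAddCommGroup F] [NormedSpace ℝ F]

/-- Translates of weakly differentiable functions are weakly differentiable. -/
theorem HasWeakPartial.translate {j : Fin 3} {f g : R3 → F} (h : HasWeakPartial j f g) {y : R3}
    {ψ : R3 → ℝ} (hψ : ContDiff ℝ ((⊤ : ℕ∞) : WithTop ℕ∞) ψ) (hc : HasCompactSupport ψ) :
    ∫ x, fderiv ℝ ψ x (EuclideanSpace.single j 1) • f (x - y) = -∫ x, ψ x • g (x - y) := by
  have h1 := h.integral_eq (fun x => ψ (x + y)) (hψ.comp (contDiff_id.add contDiff_const))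
    (hc.comp_homeomorph (Homeomorph.addRight y))
  simp only [fderiv_comp_add_right] at h1
  rw [← integral_add_right_eq_self _ y,
    ← integral_add_right_eq_self (fun x => ψ x • g (x - y)) y]
  simpa using h1

variable {κ : R3 → ℝ} {f g : R3 → F} {p q : ℝ≥0∞}

theorem integral_smul_avg [CompleteSpace F] (hp : 1 ≤ p) (hp' : p ≠ ∞) (hκ : Continuous κ)
    (hκ' : Integrable κ volume) (hf : MemLp f p volume) {u : R3 → ℝ} (hu : Continuous u)
    (hc : HasCompactSupport u) :
    ∫ x, u x • avg κ f x = ∫ y, κ y • ∫ x, u x • f (x - y) := by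
  obtain ⟨M, hM⟩ := hc.exists_bound_of_continuous hu
  have hint : Integrable (uncurry fun x y => u x • κ y • f (x - y)) (volume.prod volume) := by
    have hm : AEStronglyMeasurable (fun z : R3 × R3 => u z.1 • κ z.2 • f (z.1 - z.2))
        (volume.prod volume) :=
      (hu.comp continuous_fst).aestronglyMeasurable.smul
        ((hκ.comp continuous_snd).aestronglyMeasurable.smul (aestronglyMeasurable_comp_sub hf.1))
    refine ⟨hm, ?_⟩
    have := lintegral_mul_lintegral_translate_lt_top hp hp' hκ hκ' hf
      (hu.integrable_of_hasCompactSupport hc) (M := M.toNNReal) (fun x => by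
        rw [← ofReal_norm]
        exact ENNReal.ofReal_le_ofReal (hM x))
    rw [hasFiniteIntegral_iff_enorm]
    change ∫⁻ z : R3 × R3, ‖u z.1 • κ z.2 • f (z.1 - z.2)‖ₑ ∂(volume.prod volume) < ∞
    rw [lintegral_prod _ hm.enorm]
    refine lt_of_le_of_lt (le_of_eq (lintegral_congr fun x => ?_)) this
    rw [← lintegral_const_mul' _ _ enorm_ne_top]
    simp [enorm_smul]
  calc ∫ x, u x • avg κ f x = ∫ x, ∫ y, u x • κ y • f (x - y) := by
        simp only [avg_apply, integral_smul]
    _ = ∫ y, ∫ x, u x • κ y • f (x - y) := integral_integral_swap hint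
    _ = _ := by
        refine integral_congr_ae (Eventually.of_forall fun y => ?_)
        simp only [smul_comm (u _) (κ y), integral_smul]

/-- Weak differentiation commutes with averaging. -/
theorem HasWeakPartial.avg [CompleteSpace F] {j : Fin 3} (h : HasWeakPartial j f g)
    (hp : 1 ≤ p) (hp' : p ≠ ∞) (hq : 1 ≤ q) (hq' : q ≠ ∞) (hκ : Continuous κ)
    (hκ' : Integrable κ volume) (hf : MemLp f p volume) (hg : MemLp g q volume) :
    HasWeakPartial j (avg κ f) (avg κ g) where
  locallyIntegrable := (memLp_avg hp hp' hκ hκ' hf).locallyIntegrable hp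
  locallyIntegrable_deriv := (memLp_avg hq hq' hκ hκ' hg).locallyIntegrable hq
  integral_eq ψ hψ hc := by
    rw [integral_smul_avg hp hp' hκ hκ' hf
      ((hψ.continuous_fderiv (by simp)).clm_apply continuous_const) (hc.fderiv_apply ℝ _),
      integral_smul_avg hq hq' hκ hκ' hg hψ.continuous hc, ← integral_neg]
    simp only [h.translate hψ hc, smul_neg]

theorem HasWeakPartial.sub {j : Fin 3} {f' g' : R3 → F} (h : HasWeakPartial j f g)
    (h' : HasWeakPartial j f' g') : HasWeakPartial j (f - f') (g - g') where
  locallyIntegrable := h.locallyIntegrable.sub h'.locallyIntegrable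
  locallyIntegrable_deriv := h.locallyIntegrable_deriv.sub h'.locallyIntegrable_deriv
  integral_eq ψ hψ hc := by
    have hd : Continuous fun x => fderiv ℝ ψ x (EuclideanSpace.single j 1) :=
      (hψ.continuous_fderiv (by simp)).clm_apply continuous_const
    have hdc := hc.fderiv_apply ℝ (EuclideanSpace.single j 1)
    simp only [Pi.sub_apply, smul_sub]
    rw [integral_sub (h.locallyIntegrable.integrable_smul_left_of_hasCompactSupport hd hdc)
        (h'.locallyIntegrable.integrable_smul_left_of_hasCompactSupport hd hdc),
      integral_sub
        (h.locallyIntegrable_deriv.integrable_smul_left_of_hasCompactSupport hψ.continuous hc)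
        (h'.locallyIntegrable_deriv.integrable_smul_left_of_hasCompactSupport hψ.continuous hc),
      h.integral_eq ψ hψ hc, h'.integral_eq ψ hψ hc]
    abel

theorem HasWeakPartial.ofReal {j : Fin 3} {f g : R3 → ℝ} (h : HasWeakPartial j f g) :
    HasWeakPartial j (fun x => (f x : ℂ)) (fun x => (g x : ℂ)) where
  locallyIntegrable x := by
    obtain ⟨s, hs, hi⟩ := h.locallyIntegrable x
    exact ⟨s, hs, hi.ofReal⟩
  locallyIntegrable_deriv x := by
    obtain ⟨s, hs, hi⟩ := h.locallyIntegrable_deriv x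
    exact ⟨s, hs, hi.ofReal⟩
  integral_eq ψ hψ hc := by
    have := h.integral_eq ψ hψ hc
    simp only [Complex.real_smul, ← Complex.ofReal_mul]
    rw [integral_complex_ofReal, integral_complex_ofReal, ← Complex.ofReal_neg]
    exact_mod_cast this

end

/-! ### The low-frequency projection -/

/-- A bump in frequency space, supported in the ball of radius `1 / (2π)`, which is the ball
`|ξ| ≤ 1` in the normalization `e^{-i x·ξ}` of the Fourier transform. -/
def freqBump : ContDiffBump (0 : R3) where
  rIn := 1 / (4 * Real.pi)
  rOut := 1 / (2 * Real.pi)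
  rIn_pos := by positivity
  rIn_lt_rOut := by
    have := Real.pi_pos
    gcongr
    norm_num

/-- The frequency bump as a complex Schwartz function. -/
def freqSchwartz : 𝓢(R3, ℂ) :=
  HasCompactSupport.toSchwartzMap (f := fun x => (freqBump x : ℂ))
    (freqBump.hasCompactSupport.comp_left Complex.ofReal_zero)
    (Complex.ofRealCLM.contDiff.comp freqBump.contDiff)

theorem freqSchwartz_apply (x : R3) : freqSchwartz x = (freqBump x : ℂ) := rfl

/-- The inverse Fourier transform of the frequency bump. -/
def lowKernelC : 𝓢(R3, ℂ) := 𝓕⁻ freqSchwartz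

/-- The kernel of the low-frequency projection, as a real function, so that it also acts on real
fields. -/
def lowKernel (x : R3) : ℝ := (lowKernelC x).re

theorem fourier_lowKernelC : 𝓕 lowKernelC = freqSchwartz :=
  FourierTransform.fourier_fourierInv_eq _

/-- The kernel is real because the frequency bump is even. -/
theorem ofReal_lowKernel (x : R3) : (lowKernel x : ℂ) = lowKernelC x := by
  rw [lowKernel, ← Complex.conj_eq_iff_re, lowKernelC, SchwartzMap.fourierInv_coe,
    Real.fourierInv_eq', ← integral_conj, ← integral_neg_eq_self]
  refine integral_congr_ae (Eventually.of_forall fun v => ?_)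
  simp only [freqSchwartz_apply, smul_eq_mul, map_mul, Complex.conj_ofReal, ← Complex.exp_conj,
    Complex.conj_I, inner_neg_left, freqBump.neg]
  push_cast
  ring_nf

theorem continuous_lowKernel : Continuous lowKernel :=
  Complex.continuous_re.comp lowKernelC.continuous

theorem norm_lowKernel (x : R3) : ‖lowKernel x‖ = ‖lowKernelC x‖ := by
  rw [← ofReal_lowKernel, Complex.norm_real]

theorem integrable_lowKernel : Integrable lowKernel volume :=
  lowKernelC.integrable.re

theorem integral_lowKernel : ∫ y, lowKernel y = 1 := by
  have h : 𝓕 (lowKernelC : R3 → ℂ) 0 = 1 := by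
    rw [← SchwartzMap.fourier_coe, fourier_lowKernelC, freqSchwartz_apply,
      freqBump.one_of_mem_closedBall (by simp [freqBump.rIn_pos.le])]
    simp
  rw [Real.fourier_eq'] at h
  simp only [inner_zero_right, mul_zero, Complex.ofReal_zero, zero_mul, Complex.exp_zero,
    one_smul, ← ofReal_lowKernel] at h
  rw [integral_complex_ofReal] at h
  exact_mod_cast h

theorem lintegral_lowKernel_mul_ne_top :
    ∫⁻ y, ‖lowKernel y‖ₑ * (1 + ‖y‖ₑ) ^ 2 ≠ ∞ := by
  have hk : ∀ k : ℕ, Integrable (fun y => lowKernel y * ‖y‖ ^ k) volume := by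
    intro k
    refine (lowKernelC.integrable_pow_mul volume k).mono
      (continuous_lowKernel.mul (continuous_norm.pow k)).aestronglyMeasurable
      (Eventually.of_forall fun y => ?_)
    rw [norm_mul, norm_lowKernel, norm_mul, norm_norm, mul_comm]
  have h : Integrable (fun y => lowKernel y * (1 + ‖y‖) ^ 2) volume := by
    refine (((hk 0).add ((hk 1).const_mul 2)).add (hk 2)).congr (Eventually.of_forall fun y => ?_)
    simp only [Pi.add_apply]
    ring
  refine ne_of_eq_of_ne (lintegral_congr fun y => ?_) h.2.ne
  rw [enorm_mul, enorm_pow, Real.enorm_of_nonneg (by positivity : 0 ≤ 1 + ‖y‖),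
    ENNReal.ofReal_add zero_le_one (norm_nonneg _), ENNReal.ofReal_one, ofReal_norm]

/-- The Fourier transform of a translate of the kernel vanishes off the ball of radius
`1 / (2π)`. -/
theorem integral_fourier_mul_translate_lowKernel {ψ : 𝓢(R3, ℂ)}
    (hψ : ∀ ξ ∈ Metric.closedBall (0 : R3) (1 / (2 * Real.pi)), ψ ξ = 0) (z : R3) :
    ∫ x, (𝓕 ψ) x * lowKernelC (x - z) = 0 := by
  have h1 := SchwartzMap.integral_fourier_mul_eq ψ (lowKernelC.compSubConstCLM ℂ z)
  simp only [SchwartzMap.compSubConstCLM_apply] at h1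
  rw [h1]
  refine integral_eq_zero_of_ae (Eventually.of_forall fun ξ => ?_)
  by_cases hξ : ξ ∈ Metric.closedBall (0 : R3) (1 / (2 * Real.pi))
  · simp [hψ ξ hξ]
  · have h2 : (𝓕 (lowKernelC : R3 → ℂ)) ξ = 0 := by
      rw [← SchwartzMap.fourier_coe, fourier_lowKernelC, freqSchwartz_apply,
        freqBump.zero_of_le_dist (by
          rw [Metric.mem_closedBall, not_le] at hξ
          exact hξ.le)]
      simp
    have h3 : (𝓕 ((lowKernelC : R3 → ℂ) ∘ fun x => x + -z)) ξ = 0 := by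
      have := congrFun (VectorFourier.fourierIntegral_comp_add_right Real.fourierChar volume
        (innerₗ R3) (lowKernelC : R3 → ℂ) (-z)) ξ
      refine Eq.trans this ?_
      change _ • 𝓕 (lowKernelC : R3 → ℂ) ξ = 0
      rw [h2, smul_zero]
    have h4 : (𝓕 (lowKernelC.compSubConstCLM ℂ z)) ξ = 0 := by
      rw [SchwartzMap.fourier_coe, ← h3]
      congr 1
    simp [h4]

/-- Low-frequency parts are band-limited: by Fubini's theorem, the pairing of `κ ∗ f` with `𝓕 ψ` is
an integral of pairings of translates of `κ` with `𝓕 ψ`. -/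
theorem memFreqLp_avg {p : ℝ≥0∞} [hp : Fact (1 ≤ p)] (hp' : p ≠ ∞) {f : R3 → ℂ}
    (hf : MemLp f p volume) {R : ℝ} (hR : 1 ≤ R) : MemFreqLp p R (avg lowKernel f) := by
  have hmem := memLp_avg hp.out hp' continuous_lowKernel integrable_lowKernel hf
  refine ⟨hmem, ?_⟩
  have hball : Metric.closedBall (0 : R3) (1 / (2 * Real.pi))
      ⊆ Metric.closedBall 0 (R / (2 * Real.pi)) := by
    refine Metric.closedBall_subset_closedBall ?_
    have := Real.pi_pos
    gcongr
  refine Set.Subset.trans ?_ hball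
  rw [← Set.disjoint_compl_left_iff_subset]
  refine IsVanishingOn.disjoint_dsupport (fun ψ hψ => ?_) Metric.isClosed_closedBall.isOpen_compl
  have hψ0 : ∀ ξ ∈ Metric.closedBall (0 : R3) (1 / (2 * Real.pi)), ψ ξ = 0 := fun ξ hξ =>
    image_eq_zero_of_notMem_tsupport fun h => hψ h hξ
  rw [TemperedDistribution.fourier_apply, Lp.toTemperedDistribution_apply]
  set u : 𝓢(R3, ℂ) := 𝓕 ψ with hu
  have e1 : ∫ x, u x • (hmem.toLp _ : R3 → ℂ) x = ∫ x, ∫ z, u x * lowKernelC (x - z) * f z := by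
    refine integral_congr_ae ?_
    filter_upwards [hmem.coeFn_toLp] with x hx
    rw [hx, avg, convolution_eq_swap, smul_eq_mul, ← integral_const_mul]
    refine integral_congr_ae (Eventually.of_forall fun z => ?_)
    simp only [ContinuousLinearMap.lsmul_apply, Complex.real_smul, ofReal_lowKernel]
    ring
  have hint : Integrable (uncurry fun x z => u x * lowKernelC (x - z) * f z)
      (volume.prod volume) := by
    have hm : AEStronglyMeasurable (fun w : R3 × R3 => u w.1 * lowKernelC (w.1 - w.2) * f w.2)
        (volume.prod volume) :=
      ((u.continuous.comp continuous_fst).mul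
        (lowKernelC.continuous.comp (continuous_fst.sub continuous_snd))).aestronglyMeasurable.mul
        hf.1.comp_snd
    refine ⟨hm, ?_⟩
    obtain ⟨M, hM⟩ := u.decay 0 0
    have := lintegral_mul_lintegral_translate_lt_top hp.out hp' continuous_lowKernel
      integrable_lowKernel hf u.integrable (M := M.toNNReal) (fun x => by
        rw [← ofReal_norm]
        exact ENNReal.ofReal_le_ofReal (by simpa using hM.2 x))
    rw [hasFiniteIntegral_iff_enorm]
    change ∫⁻ w : R3 × R3, ‖u w.1 * lowKernelC (w.1 - w.2) * f w.2‖ₑ ∂(volume.prod volume) < ∞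
    rw [lintegral_prod _ hm.enorm]
    refine lt_of_le_of_lt (le_of_eq (lintegral_congr fun x => ?_)) this
    rw [← lintegral_const_mul' _ _ enorm_ne_top,
      ← lintegral_sub_left_eq_self _ x]
    refine lintegral_congr fun z => ?_
    simp only [enorm_mul, sub_sub_cancel, ← ofReal_lowKernel, mul_assoc]
    congr 2
    simp [enorm_eq_nnnorm]
  rw [e1, integral_integral_swap hint]
  refine integral_eq_zero_of_ae (Eventually.of_forall fun z => ?_)
  simp only [Pi.zero_apply]
  rw [integral_mul_const, integral_fourier_mul_translate_lowKernel hψ0, zero_mul]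

/-! ### Differences of translates in `L³` -/

theorem lintegral_enorm_pow_eq {E : Type*} [TopologicalSpace E] [ContinuousENorm E] {f : R3 → E}
    {n : ℕ} (hn : n ≠ 0) : ∫⁻ x, ‖f x‖ₑ ^ n = eLpNorm f n volume ^ n := by
  have := eLpNorm_nnreal_pow_eq_lintegral (f := f) (μ := (volume : Measure R3)) (p := n)
    (by exact_mod_cast hn)
  simp only [NNReal.coe_natCast, ENNReal.rpow_natCast, ENNReal.coe_natCast] at this
  exact this.symm

/-- A function in `(L² + L³) ∩ L⁶` is in `L³`: where `F` dominates `G`, use `t³ ≤ t² + t⁶`, and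
elsewhere `t ≤ 2 G`. -/
theorem eLpNorm_three_le {E : Type*} [NormedAddCommGroup E] {t : R3 → E} {F G : R3 → ℝ≥0∞}
    (hF : Measurable F) (hG : Measurable G) (h : ∀ x, ‖t x‖ₑ ≤ F x + G x)
    {c : ℝ≥0∞} (hc : 1 ≤ c) (hF2 : eLpNorm F 2 volume ≤ c) (hG3 : eLpNorm G 3 volume ≤ c)
    (ht6 : eLpNorm t 6 volume ≤ c) : eLpNorm t 3 volume ≤ 13 * c ^ 2 := by
  have hpt : ∀ x, ‖t x‖ₑ ^ 3 ≤ 4 * ‖F x‖ₑ ^ 2 + 8 * ‖G x‖ₑ ^ 3 + ‖t x‖ₑ ^ 6 := by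
    intro x
    simp only [enorm_eq_self]
    rcases le_total (G x) (F x) with hGF | hGF
    · have h2 : ‖t x‖ₑ ^ 3 ≤ ‖t x‖ₑ ^ 2 + ‖t x‖ₑ ^ 6 := by
        rcases le_total ‖t x‖ₑ 1 with h1 | h1
        · exact (pow_le_pow_right_of_le_one' h1 (by norm_num)).trans le_self_add
        · exact (pow_le_pow_right₀ h1 (by norm_num)).trans le_add_self
      have h3 : ‖t x‖ₑ ^ 2 ≤ 4 * F x ^ 2 := by
        calc ‖t x‖ₑ ^ 2 ≤ (2 * F x) ^ 2 := by
              gcongr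
              exact (h x).trans (by rw [two_mul]; gcongr)
          _ = 4 * F x ^ 2 := by rw [mul_pow]; norm_num
      calc ‖t x‖ₑ ^ 3 ≤ ‖t x‖ₑ ^ 2 + ‖t x‖ₑ ^ 6 := h2
        _ ≤ (4 * F x ^ 2 + 8 * G x ^ 3) + ‖t x‖ₑ ^ 6 := by
          gcongr
          exact h3.trans le_self_add
    · calc ‖t x‖ₑ ^ 3 ≤ (2 * G x) ^ 3 := by
            gcongr
            exact (h x).trans (by rw [two_mul]; gcongr)
        _ = 8 * G x ^ 3 := by rw [mul_pow]; norm_num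
        _ ≤ _ := le_add_self.trans le_self_add
  have h3 : eLpNorm t 3 volume ^ 3 ≤ (13 * c ^ 2) ^ 3 := by
    have e3 := lintegral_enorm_pow_eq (f := t) (n := 3) (by norm_num)
    have e6 := lintegral_enorm_pow_eq (f := t) (n := 6) (by norm_num)
    have eF := lintegral_enorm_pow_eq (f := F) (n := 2) (by norm_num)
    have eG := lintegral_enorm_pow_eq (f := G) (n := 3) (by norm_num)
    simp only [Nat.cast_ofNat] at e3 e6 eF eG
    rw [← e3]
    calc ∫⁻ x, ‖t x‖ₑ ^ 3
        ≤ ∫⁻ x, (4 * ‖F x‖ₑ ^ 2 + 8 * ‖G x‖ₑ ^ 3 + ‖t x‖ₑ ^ 6) := lintegral_mono hpt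
      _ = 4 * eLpNorm F 2 volume ^ 2 + 8 * eLpNorm G 3 volume ^ 3 + eLpNorm t 6 volume ^ 6 := by
        rw [lintegral_add_left (by fun_prop), lintegral_add_left (by fun_prop),
          lintegral_const_mul _ (by fun_prop), lintegral_const_mul _ (by fun_prop), e6, eF, eG]
      _ ≤ 4 * c ^ 6 + 8 * c ^ 6 + c ^ 6 := by
        gcongr
        · norm_num
        · norm_num
      _ = 13 * c ^ 6 := by ring
      _ ≤ 13 ^ 3 * c ^ 6 := by gcongr; norm_num
      _ = (13 * c ^ 2) ^ 3 := by ring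
  exact (ENNReal.pow_le_pow_left_iff three_ne_zero).1 h3

theorem eLpNorm_sum_enorm_le {E : Type*} [NormedAddCommGroup E] {p : ℝ≥0∞} (hp : 1 ≤ p)
    {u : Fin 3 → R3 → E} (hu : ∀ j, Continuous (u j)) {c : ℝ≥0∞}
    (hc : ∀ j, eLpNorm (u j) p volume ≤ c) :
    eLpNorm (fun x => ∑ j, ‖u j x‖ₑ) p volume ≤ 3 * c := by
  have := eLpNorm_sum_le (μ := (volume : Measure R3)) (p := p) (s := Finset.univ)
    (f := fun (j : Fin 3) x => ‖u j x‖ₑ)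
    (fun j _ => (hu j).enorm.measurable.aestronglyMeasurable) hp
  have e : (fun x => ∑ j, ‖u j x‖ₑ) = ∑ j, fun x => ‖u j x‖ₑ := by
    ext x
    simp
  rw [e]
  refine this.trans ((Finset.sum_le_sum fun j _ => ?_).trans (le_of_eq
    (by simp : ∑ _j : Fin 3, c = 3 * c)))
  rw [eLpNorm_enorm]
  exact hc j

/-- If `f ∈ L⁶` and `∇f ∈ L² + L³`, then `f - τ_y f ∈ L³`, with a norm growing at most
polynomially in `y`. -/
theorem eLpNorm_three_sub_translate_le {F : Type*} [NormedAddCommGroup F] [NormedSpace ℝ F]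
    [CompleteSpace F] {f : R3 → F} {d e : Fin 3 → R3 → F}
    (h : ∀ j, HasWeakPartial j f (d j + e j)) {c : ℝ≥0} (hc : 1 ≤ c)
    (hdm : ∀ j, AEStronglyMeasurable (d j) volume)
    (hem : ∀ j, AEStronglyMeasurable (e j) volume)
    (hd : ∀ j, eLpNorm (d j) 2 volume ≤ c) (he : ∀ j, eLpNorm (e j) 3 volume ≤ c)
    (h6 : eLpNorm f 6 volume ≤ c) (y : R3) :
    eLpNorm (f - translate y f) 3 volume ≤ 117 * c ^ 2 * (1 + ‖y‖ₑ) ^ 2 := by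
  have hf := (h 0).locallyIntegrable
  have hlim := ae_tendsto_mollify hf
  have hdl : ∀ j, LocallyIntegrable (d j) volume := fun j =>
    MemLp.locallyIntegrable (p := 2) ⟨hdm j, (hd j).trans_lt ENNReal.coe_lt_top⟩ one_le_two
  have hel : ∀ j, LocallyIntegrable (e j) volume := fun j =>
    MemLp.locallyIntegrable (p := 3) ⟨hem j, (he j).trans_lt ENNReal.coe_lt_top⟩ (by norm_num)
  refine eLpNorm_le_of_tendsto (u := fun n => mollify n f - translate y (mollify n f))
    (fun n => (continuous_mollify hf n).aestronglyMeasurable.sub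
      (aestronglyMeasurable_translate (continuous_mollify hf n).aestronglyMeasurable y))
    ?_ (fun n => ?_) tendsto_const_nhds
  · filter_upwards [hlim, ae_tendsto_translate hlim y] with x h1 h2
    exact h1.sub h2
  set D : R3 → ℝ≥0∞ := fun z => ∑ j, ‖mollify n (d j) z‖ₑ with hD
  set E : R3 → ℝ≥0∞ := fun z => ∑ j, ‖mollify n (e j) z‖ₑ with hE
  have hDm : Measurable D := Finset.measurable_sum _ fun j _ =>
    (continuous_mollify (hdl j) n).enorm.measurable
  have hEm : Measurable E := Finset.measurable_sum _ fun j _ =>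
    (continuous_mollify (hel j) n).enorm.measurable
  have hfd : ∀ z, ‖fderiv ℝ (mollify n f) z‖ₑ ≤ D z + E z := by
    intro z
    refine (enorm_le_sum_enorm_apply_single _).trans ?_
    rw [hD, hE, ← Finset.sum_add_distrib]
    refine Finset.sum_le_sum fun j _ => ?_
    rw [fderiv_mollify (h j), mollify_add (hdl j) (hel j)]
    exact enorm_add_le _ _
  have hseg : ∀ {p : ℝ≥0∞} (_ : 1 ≤ p) (_ : p ≠ ∞) {G : R3 → ℝ≥0∞} (_ : Measurable G)
      (_ : eLpNorm G p volume ≤ 3 * c),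
      eLpNorm (fun x => ‖y‖ₑ * segAvg y G x) p volume ≤ 3 * c * (1 + ‖y‖ₑ) := by
    intro p hp hp' G hG hGc
    have := eLpNorm_le_mul_eLpNorm_of_ae_le_mul'' (p := p) (μ := (volume : Measure R3))
      (f := fun x => ‖y‖ₑ * segAvg y G x) (g := segAvg y G) (c := ‖y‖ₑ)
      (measurable_segAvg hG y).aestronglyMeasurable (Eventually.of_forall fun x => by simp)
    refine this.trans ?_
    rw [mul_comm (3 * (c : ℝ≥0∞))]
    exact mul_le_mul' le_add_self ((eLpNorm_segAvg_le hp hp' hG y).trans hGc)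
  have hmem6 : AEStronglyMeasurable (mollify n f) volume :=
    (continuous_mollify hf n).aestronglyMeasurable
  have hn6 : eLpNorm (mollify n f) 6 volume ≤ c :=
    (eLpNorm_mollify_le (by norm_num) ENNReal.ofNat_ne_top hf.aestronglyMeasurable n).trans h6
  have hc1 : (1 : ℝ≥0∞) ≤ c := by exact_mod_cast hc
  refine (eLpNorm_three_le (F := fun x => ‖y‖ₑ * segAvg y D x)
    (G := fun x => ‖y‖ₑ * segAvg y E x) (c := 3 * c * (1 + ‖y‖ₑ))
    ((measurable_segAvg hDm y).const_mul _) ((measurable_segAvg hEm y).const_mul _)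
    (fun x => ?_) ?_ ?_ ?_ ?_).trans (le_of_eq ?_)
  · have := enorm_sub_le_segAvg (contDiff_mollify hf n 1) hfd y x
    rw [segAvg_add hDm, mul_add] at this
    exact this
  · calc (1 : ℝ≥0∞) = 1 * 1 * (1 + 0) := by norm_num
      _ ≤ _ := by
        gcongr
        · norm_num
        · exact zero_le
  · exact hseg one_le_two ENNReal.ofNat_ne_top hDm (eLpNorm_sum_enorm_le one_le_two
      (fun j => continuous_mollify (hdl j) n) fun j =>
        (eLpNorm_mollify_le one_le_two ENNReal.ofNat_ne_top (hdm j) n).trans (hd j))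
  · exact hseg (by norm_num) ENNReal.ofNat_ne_top hEm (eLpNorm_sum_enorm_le (by norm_num)
      (fun j => continuous_mollify (hel j) n) fun j =>
        (eLpNorm_mollify_le (by norm_num) ENNReal.ofNat_ne_top (hem j) n).trans (he j))
  · refine (eLpNorm_sub_le hmem6 (aestronglyMeasurable_translate hmem6 y) (by norm_num)).trans ?_
    rw [eLpNorm_translate hmem6]
    calc eLpNorm (mollify n f) 6 volume + eLpNorm (mollify n f) 6 volume ≤ c + c :=
          add_le_add hn6 hn6
      _ = 2 * c * (1 + 0) := by rw [add_zero, mul_one, two_mul]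
      _ ≤ _ := by
        gcongr
        · norm_num
        · exact zero_le
  · ring

/-! ### The gauge terms -/

/-- The difference `i a φ` between a covariant derivative of `φ` and an ordinary one. -/
def gaugeTerm (a : R3 → ℝ) (φ : R3 → ℂ) : R3 → ℂ := fun x => Complex.I * (a x : ℂ) * φ x

section

variable {a : R3 → ℝ} {φ : R3 → ℂ}

theorem aestronglyMeasurable_gaugeTerm (ha : AEStronglyMeasurable a volume)
    (hφ : AEStronglyMeasurable φ volume) : AEStronglyMeasurable (gaugeTerm a φ) volume :=
  ((Complex.continuous_ofReal.comp_aestronglyMeasurable ha).const_mul _).mul hφ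

theorem eLpNorm_gaugeTerm_le {p q r : ℝ≥0∞} [ENNReal.HolderTriple p q r]
    (ha : AEStronglyMeasurable a volume) (hφ : AEStronglyMeasurable φ volume) :
    eLpNorm (gaugeTerm a φ) r volume ≤ eLpNorm a p volume * eLpNorm φ q volume := by
  refine (eLpNorm_mono fun x => ?_).trans (eLpNorm_smul_le_mul_eLpNorm (φ := a) (f := φ) hφ ha)
  simp [gaugeTerm]

/-- Leibniz rule for differences of translates. -/
theorem gaugeTerm_sub_translate (y : R3) :
    gaugeTerm a φ - translate y (gaugeTerm a φ)
      = gaugeTerm (a - translate y a) φ + gaugeTerm (translate y a) (φ - translate y φ) := by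
  ext x
  simp only [gaugeTerm, translate, Pi.sub_apply, Pi.add_apply, Complex.ofReal_sub]
  ring

theorem eLpNorm_two_gaugeTerm_sub_translate_le (ha : AEStronglyMeasurable a volume)
    (hφ : AEStronglyMeasurable φ volume) {c : ℝ≥0} (ha6 : eLpNorm a 6 volume ≤ c)
    (hφ6 : eLpNorm φ 6 volume ≤ c) {m : ℝ≥0∞} {y : R3}
    (hay : eLpNorm (a - translate y a) 3 volume ≤ m)
    (hφy : eLpNorm (φ - translate y φ) 3 volume ≤ m) :
    eLpNorm (gaugeTerm a φ - translate y (gaugeTerm a φ)) 2 volume ≤ 2 * c * m := by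
  have hta := aestronglyMeasurable_translate ha y
  have hda := ha.sub hta
  have hdφ := hφ.sub (aestronglyMeasurable_translate hφ y)
  rw [gaugeTerm_sub_translate]
  refine (eLpNorm_add_le (aestronglyMeasurable_gaugeTerm hda hφ)
    (aestronglyMeasurable_gaugeTerm hta hdφ) one_le_two).trans ?_
  calc _ ≤ m * c + c * m := add_le_add
        ((eLpNorm_gaugeTerm_le (p := 3) (q := 6) hda hφ).trans (mul_le_mul' hay hφ6))
        ((eLpNorm_gaugeTerm_le (p := 6) (q := 3) hta hdφ).trans
          (mul_le_mul' ((eLpNorm_translate ha 6 y).trans_le ha6) hφy))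
    _ = 2 * c * m := by ring

end

/-! ### Low and high frequencies -/

theorem one_add_enorm_sq_ne_zero (y : R3) : (1 + ‖y‖ₑ) ^ 2 ≠ 0 :=
  pow_ne_zero _ (ne_of_gt (zero_lt_one.trans_le le_self_add))

/-- The weighted mass of the low-frequency kernel, which also dominates its plain mass. -/
def lowMass : ℝ≥0 := (∫⁻ y, ‖lowKernel y‖ₑ * (1 + ‖y‖ₑ) ^ 2).toNNReal

theorem coe_lowMass : (lowMass : ℝ≥0∞) = ∫⁻ y, ‖lowKernel y‖ₑ * (1 + ‖y‖ₑ) ^ 2 :=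
  ENNReal.coe_toNNReal lintegral_lowKernel_mul_ne_top

section

variable {F : Type*} [NormedAddCommGroup F] [NormedSpace ℝ F] {f : R3 → F} {p : ℝ≥0∞}

theorem memLp_avg_lowKernel (hp : 1 ≤ p) (hp' : p ≠ ∞) (hf : MemLp f p volume) :
    MemLp (avg lowKernel f) p volume :=
  memLp_avg hp hp' continuous_lowKernel integrable_lowKernel hf

theorem eLpNorm_avg_lowKernel_le (hp : 1 ≤ p) (hp' : p ≠ ∞) (hf : AEStronglyMeasurable f volume)
    {c : ℝ≥0} (hc : eLpNorm f p volume ≤ c) :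
    eLpNorm (avg lowKernel f) p volume ≤ (lowMass * c : ℝ≥0) := by
  refine (eLpNorm_avg_le hp hp' continuous_lowKernel integrable_lowKernel hf).trans ?_
  rw [ENNReal.coe_mul, coe_lowMass]
  refine mul_le_mul' (lintegral_mono fun y => ?_) hc
  exact le_mul_of_one_le_right zero_le (one_le_pow₀ le_self_add)

theorem eLpNorm_sub_avg_lowKernel_le (hp : 1 ≤ p) (hp' : p ≠ ∞) (hf : MemLp f p volume)
    {c : ℝ≥0} (hc : eLpNorm f p volume ≤ c) :
    eLpNorm (f - avg lowKernel f) p volume ≤ ((1 + lowMass) * c : ℝ≥0) := by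
  refine (eLpNorm_sub_le hf.1 (memLp_avg_lowKernel hp hp' hf).1 hp).trans ?_
  rw [add_mul, one_mul, ENNReal.coe_add]
  exact add_le_add hc (eLpNorm_avg_lowKernel_le hp hp' hf.1 hc)

/-- High frequencies are controlled by differences of translates. -/
theorem eLpNorm_two_sub_avg_lowKernel_le [CompleteSpace F] (hp : 1 ≤ p) (hp' : p ≠ ∞)
    (hf : MemLp f p volume) {c : ℝ≥0}
    (hc : ∀ y, eLpNorm (f - translate y f) 2 volume ≤ c * (1 + ‖y‖ₑ) ^ 2) :
    eLpNorm (f - avg lowKernel f) 2 volume ≤ (lowMass * c : ℝ≥0) := by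
  rw [ENNReal.coe_mul, coe_lowMass]
  exact eLpNorm_sub_avg_le one_le_two ENNReal.ofNat_ne_top continuous_lowKernel
    integral_lowKernel hf.1
    (ae_integrable_smul_translate hp hp' continuous_lowKernel integrable_lowKernel hf)
    (by fun_prop) one_add_enorm_sq_ne_zero (fun y => by finiteness)
    lintegral_lowKernel_mul_ne_top fun y _ => hc y

theorem avg_lowKernel_add {g : R3 → F} {q : ℝ≥0∞} (hp : 1 ≤ p) (hp' : p ≠ ∞) (hq : 1 ≤ q)
    (hq' : q ≠ ∞) (hf : MemLp f p volume) (hg : MemLp g q volume) :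
    avg lowKernel (f + g) =ᵐ[volume] avg lowKernel f + avg lowKernel g := by
  filter_upwards [ae_integrable_smul_translate hp hp' continuous_lowKernel integrable_lowKernel hf,
    ae_integrable_smul_translate hq hq' continuous_lowKernel integrable_lowKernel hg] with x h1 h2
  simp only [Pi.add_apply, avg_apply, smul_add]
  exact integral_add h1 h2

end

theorem h1Norm_le {F : Type*} [NormedAddCommGroup F] [NormedSpace ℝ F] [CompleteSpace F]
    {f : R3 → F} {g : Fin 3 → R3 → F} (h : ∀ j, HasWeakPartial j f (g j)) {c : ℝ≥0}
    (hf : eLpNorm f 2 volume ≤ c) (hg : ∀ j, eLpNorm (g j) 2 volume ≤ c) :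
    h1Norm f ≤ (2 * c : ℝ≥0) := by
  have hw : ∀ j, eLpNorm (weakPartial j f) 2 volume ≤ c := fun j =>
    (eLpNorm_congr_ae ((hasWeakPartial_weakPartial ⟨g j, h j⟩).ae_eq (h j))).trans_le (hg j)
  have h1 : eLpNorm f 2 volume ^ 2 + ∑ j : Fin 3, eLpNorm (weakPartial j f) 2 volume ^ 2
      ≤ (2 * c : ℝ≥0) ^ (2 : ℝ) := by
    calc _ ≤ (c : ℝ≥0∞) ^ 2 + ∑ _j : Fin 3, (c : ℝ≥0∞) ^ 2 := by
          gcongr with j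
          exact hw j
      _ = _ := by
          rw [ENNReal.rpow_ofNat]
          simp only [Finset.sum_const, Finset.card_univ, Fintype.card_fin, nsmul_eq_mul,
            ENNReal.coe_mul]
          push_cast
          ring
  refine (ENNReal.rpow_le_rpow h1 (by norm_num : (0 : ℝ) ≤ 1 / 2)).trans (le_of_eq ?_)
  rw [← ENNReal.rpow_mul]
  norm_num

/-- A function in `L⁶` whose gradient has its high frequencies in `L²` is in `H¹ + L⁶_1`: the part
in `H¹` is obtained by removing the low frequencies twice, once to have the gradient in `L²` and
once to have the function itself there. -/
theorem inBallH1AddL6 {f : R3 → ℂ} {g : Fin 3 → R3 → ℂ} (h : ∀ j, HasWeakPartial j f (g j))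
    (hg : ∀ j, MemLp (g j) 2 volume) {c : ℝ≥0} (h6 : eLpNorm f 6 volume ≤ c)
    (hc : ∀ j, eLpNorm (g j - avg lowKernel (g j)) 2 volume ≤ c) :
    InBallH1AddL6 (10 * (1 + lowMass) ^ 2 * c) f := by
  have h16 : (1 : ℝ≥0∞) ≤ 6 := by norm_num
  have h6t : (6 : ℝ≥0∞) ≠ ∞ := ENNReal.ofNat_ne_top
  have h2t : (2 : ℝ≥0∞) ≠ ∞ := ENNReal.ofNat_ne_top
  have hf6 : MemLp f 6 volume :=
    ⟨(h 0).locallyIntegrable.aestronglyMeasurable, h6.trans_lt ENNReal.coe_lt_top⟩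
  have hlow : ∀ {u v : R3 → ℂ} {j : Fin 3}, HasWeakPartial j u v → MemLp u 6 volume →
      MemLp v 2 volume → HasWeakPartial j (u - avg lowKernel u) (v - avg lowKernel v) :=
    fun huv hu hv => huv.sub (huv.avg h16 h6t one_le_two h2t continuous_lowKernel
      integrable_lowKernel hu hv)
  set f' := f - avg lowKernel f with hf'
  set g' : Fin 3 → R3 → ℂ := fun j => g j - avg lowKernel (g j) with hg'
  have hf'6 : MemLp f' 6 volume := hf6.sub (memLp_avg_lowKernel h16 h6t hf6)
  have hg'2 : ∀ j, MemLp (g' j) 2 volume := fun j =>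
    (hg j).sub (memLp_avg_lowKernel one_le_two h2t (hg j))
  have hw' : ∀ j, HasWeakPartial j f' (g' j) := fun j => hlow (h j) hf6 (hg j)
  set f'' := f' - avg lowKernel f' with hf''
  set g'' : Fin 3 → R3 → ℂ := fun j => g' j - avg lowKernel (g' j) with hg''
  have hg''2 : ∀ j, MemLp (g'' j) 2 volume := fun j =>
    (hg'2 j).sub (memLp_avg_lowKernel one_le_two h2t (hg'2 j))
  have hw'' : ∀ j, HasWeakPartial j f'' (g'' j) := fun j => hlow (hw' j) hf'6 (hg'2 j)
  have n1 : eLpNorm f'' 2 volume ≤ (lowMass * (3 * c) : ℝ≥0) := by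
    refine eLpNorm_two_sub_avg_lowKernel_le h16 h6t hf'6 fun y => ?_
    refine (HasWeakPartial.eLpNorm_sub_translate_le one_le_two h2t hw' y).trans ?_
    rw [mul_comm]
    refine mul_le_mul' ((Finset.sum_le_sum fun j _ => hc j).trans (le_of_eq (by simp))) ?_
    calc ‖y‖ₑ ≤ 1 + ‖y‖ₑ := le_add_self
      _ ≤ (1 + ‖y‖ₑ) ^ 2 := le_self_pow₀ le_self_add two_ne_zero
  have n2 : ∀ j, eLpNorm (g'' j) 2 volume ≤ ((1 + lowMass) * c : ℝ≥0) := fun j =>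
    eLpNorm_sub_avg_lowKernel_le one_le_two h2t (hg'2 j) (hc j)
  have n3 : eLpNorm (f + f') 6 volume ≤ (c + (1 + lowMass) * c : ℝ≥0) := by
    rw [ENNReal.coe_add]
    exact (eLpNorm_add_le hf6.1 hf'6.1 h16).trans
      (add_le_add h6 (eLpNorm_sub_avg_lowKernel_le h16 h6t hf6 h6))
  have m1 : eLpNorm f'' 2 volume ≤ (3 * (1 + lowMass) * c : ℝ≥0) := by
    refine n1.trans (ENNReal.coe_le_coe.2 ?_)
    calc lowMass * (3 * c) = 3 * lowMass * c := by ring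
      _ ≤ 3 * (1 + lowMass) * c := by gcongr; exact le_add_self
  have m2 : ∀ j, eLpNorm (g'' j) 2 volume ≤ (3 * (1 + lowMass) * c : ℝ≥0) := fun j => by
    refine (n2 j).trans (ENNReal.coe_le_coe.2 ?_)
    gcongr
    exact le_mul_of_one_le_left zero_le (by norm_num)
  refine ⟨f'', avg lowKernel (f + f'), ?_, ⟨⟨?_, fun j => ⟨g'' j, hw'' j, hg''2 j⟩⟩, ?_⟩, ?_, ?_⟩
  · filter_upwards [avg_lowKernel_add h16 h6t h16 h6t hf6 hf'6] with x hx
    simp only [Pi.add_apply] at hx ⊢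
    rw [hx, hf'', hf']
    simp only [Pi.sub_apply]
    ring
  · exact ⟨(hw'' 0).locallyIntegrable.aestronglyMeasurable, n1.trans_lt ENNReal.coe_lt_top⟩
  · refine (h1Norm_le hw'' m1 m2).trans (ENNReal.coe_le_coe.2 ?_)
    calc 2 * (3 * (1 + lowMass) * c) = 6 * (1 + lowMass) ^ 1 * c := by ring
      _ ≤ 10 * (1 + lowMass) ^ 2 * c := by
        gcongr
        · norm_num
        · exact le_self_add
        · norm_num
  · exact memFreqLp_avg h6t (hf6.add hf'6) le_rfl
  · refine (eLpNorm_avg_lowKernel_le h16 h6t (hf6.add hf'6).1 n3).trans (ENNReal.coe_le_coe.2 ?_)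
    calc lowMass * (c + (1 + lowMass) * c) ≤ (1 + lowMass) * (2 * (1 + lowMass) * c) := by
          gcongr
          · exact le_add_self
          · calc c + (1 + lowMass) * c ≤ (1 + lowMass) * c + (1 + lowMass) * c :=
                  add_le_add_left (le_mul_of_one_le_left zero_le le_self_add) _
              _ = 2 * (1 + lowMass) * c := by ring
      _ = 2 * (1 + lowMass) ^ 2 * c := by ring
      _ ≤ 10 * (1 + lowMass) ^ 2 * c := by gcongr; norm_num

/-- The decomposition `f = (v - (u - κ ∗ u)) - κ ∗ u` of `f = v - u`. -/
theorem inBallL2AddL3_of_sub {f u v : R3 → ℂ} (hf : ∀ x, v x = f x + u x) (hv : MemLp v 2 volume)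
    (hu : MemLp u 3 volume) {c : ℝ≥0} (hv2 : eLpNorm v 2 volume ≤ c)
    (hu3 : eLpNorm u 3 volume ≤ c) (hh : eLpNorm (u - avg lowKernel u) 2 volume ≤ c) :
    InBallL2AddL3 ((2 + lowMass) * c) f := by
  have h13 : (1 : ℝ≥0∞) ≤ 3 := by norm_num
  have h3t : (3 : ℝ≥0∞) ≠ ∞ := ENNReal.ofNat_ne_top
  have hneg : avg lowKernel (-u) = -avg lowKernel u := by
    ext x
    simp [avg_apply, integral_neg]
  have hmem : MemLp (avg lowKernel u) 3 volume := memLp_avg_lowKernel h13 h3t hu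
  have hm : AEStronglyMeasurable (u - avg lowKernel u) volume := hu.1.sub hmem.1
  have hn := (eLpNorm_sub_le hv.1 hm one_le_two).trans (add_le_add hv2 hh)
  refine ⟨v - (u - avg lowKernel u), avg lowKernel (-u), ?_, ⟨⟨hv.1.sub hm, ?_⟩, ?_⟩, ?_, ?_⟩
  · refine Eventually.of_forall fun x => ?_
    rw [hneg]
    simp only [Pi.add_apply, Pi.sub_apply, Pi.neg_apply, hf]
    ring
  · exact hn.trans_lt (by finiteness)
  · refine hn.trans ?_
    rw [← ENNReal.coe_add, ENNReal.coe_le_coe, ← two_mul]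
    gcongr
    exact le_self_add
  · exact memFreqLp_avg h3t hu.neg one_le_two
  · rw [hneg, eLpNorm_neg]
    refine (eLpNorm_avg_lowKernel_le h13 h3t hu.1 hu3).trans (ENNReal.coe_le_coe.2 ?_)
    gcongr
    exact le_add_self

theorem inBallL2AddL3_ofReal {f : R3 → ℝ} {c : ℝ≥0} (hf : MemLp f 2 volume)
    (hc : eLpNorm f 2 volume ≤ c) : InBallL2AddL3 ((2 + lowMass) * c) fun x => (f x : ℂ) := by
  have h0 : avg lowKernel (0 : R3 → ℂ) = 0 := by
    ext x
    simp [avg_apply]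
  refine inBallL2AddL3_of_sub (u := 0) (v := fun x => (f x : ℂ)) (by simp) hf.ofReal MemLp.zero
    ?_ (by simp) (by simp [h0])
  exact (eLpNorm_mono fun x => by simp).trans hc

theorem InBallL2.mono {F : Type*} [NormedAddCommGroup F] {f : R3 → F} {c c' : ℝ≥0}
    (h : InBallL2 c f) (hcc' : c ≤ c') : InBallL2 c' f :=
  ⟨h.1, h.2.trans (ENNReal.coe_le_coe.2 hcc')⟩

theorem InBallL2AddL3.mono {f : R3 → ℂ} {c c' : ℝ≥0} (h : InBallL2AddL3 c f) (hcc' : c ≤ c') :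
    InBallL2AddL3 c' f := by
  obtain ⟨g, u, hfg, hg, hu, hu'⟩ := h
  exact ⟨g, u, hfg, hg.mono hcc', hu, hu'.trans (ENNReal.coe_le_coe.2 hcc')⟩

theorem InBallH1AddL6.mono {f : R3 → ℂ} {c c' : ℝ≥0} (h : InBallH1AddL6 c f) (hcc' : c ≤ c') :
    InBallH1AddL6 c' f := by
  obtain ⟨g, u, hfg, ⟨hg, hg'⟩, hu, hu'⟩ := h
  exact ⟨g, u, hfg, ⟨hg, hg'.trans (ENNReal.coe_le_coe.2 hcc')⟩, hu,
    hu'.trans (ENNReal.coe_le_coe.2 hcc')⟩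

/-- A real function in `L⁶` with gradient in `L²` is in `H¹ + L⁶_1`. -/
theorem inBallH1AddL6_ofReal {f : R3 → ℝ} {g : Fin 3 → R3 → ℝ} (h : ∀ j, HasWeakPartial j f (g j))
    {c : ℝ≥0} (h6 : eLpNorm f 6 volume ≤ c) (hg : ∀ j, eLpNorm (g j) 2 volume ≤ c) :
    InBallH1AddL6 (10 * (1 + lowMass) ^ 2 * ((1 + lowMass) * c)) fun x => (f x : ℂ) := by
  have e : ∀ (u : R3 → ℝ) (p : ℝ≥0∞), eLpNorm (fun x => (u x : ℂ)) p volume ≤ eLpNorm u p volume :=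
    fun u p => eLpNorm_mono fun x => by simp
  have hmem : ∀ j, MemLp (fun x => (g j x : ℂ)) 2 volume := fun j =>
    ⟨Complex.continuous_ofReal.comp_aestronglyMeasurable
      (h j).locallyIntegrable_deriv.aestronglyMeasurable,
      ((e _ _).trans (hg j)).trans_lt ENNReal.coe_lt_top⟩
  refine inBallH1AddL6 (fun j => (h j).ofReal) hmem ((e _ _).trans (h6.trans ?_)) fun j =>
    eLpNorm_sub_avg_lowKernel_le one_le_two ENNReal.ofNat_ne_top (hmem j) ((e _ _).trans (hg j))
  exact ENNReal.coe_le_coe.2 (le_mul_of_one_le_left zero_le le_self_add)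

/-! ### Consequences of the energy bounds -/

/-- The products of the potentials with `φ` are in `L³`, and their high frequencies in `L²`. Here
`a` is any potential with the bounds of `A0` and of the `A k`. -/
theorem exists_gaugeTerm_bounds (c : ℝ≥0) :
    ∃ c' : ℝ≥0, ∀ {A0 : R3 → ℝ} {A At : Fin 3 → R3 → ℝ} {φ φt : R3 → ℂ},
      IsEnergyClass A0 A At φ φt → EnergyBounds c A0 A At φ φt →
      ∀ {a : R3 → ℝ} {g : Fin 3 → R3 → ℝ}, (∀ j, HasWeakPartial j a (g j)) →
        (∀ j, eLpNorm (g j) 2 volume ≤ c) → eLpNorm a 6 volume ≤ c →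
        MemLp (gaugeTerm a φ) 3 volume ∧ eLpNorm (gaugeTerm a φ) 3 volume ≤ c' ∧
          eLpNorm (gaugeTerm a φ - avg lowKernel (gaugeTerm a φ)) 2 volume ≤ c' := by
  -- `c * c` bounds the part `A_j φ` of `∂_j φ` in `L³`.
  set b : ℝ≥0 := 1 + c + c * c with hb
  have hb1 : 1 ≤ b := by rw [hb, add_assoc]; exact le_self_add
  have hbc : (c : ℝ≥0∞) ≤ b := ENNReal.coe_le_coe.2 (le_add_self.trans le_self_add)
  have hbcc : (c : ℝ≥0∞) * c ≤ b := by
    rw [← ENNReal.coe_mul, ENNReal.coe_le_coe]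
    exact le_add_self
  refine ⟨b + lowMass * (234 * b ^ 3), fun {A0 A At φ φt} hE hB {a g} ha hg ha6 => ?_⟩
  have h13 : (1 : ℝ≥0∞) ≤ 3 := by norm_num
  have hφm : AEStronglyMeasurable φ volume := hE.memφ.1.1
  have ham := (ha 0).locallyIntegrable.aestronglyMeasurable
  have hAφm : ∀ j, AEStronglyMeasurable (gaugeTerm (A j) φ) volume := fun j =>
    aestronglyMeasurable_gaugeTerm (hE.memA j).1.1 hφm
  have hcov : ∀ j, weakPartial j φ = covSpace A φ j + -gaugeTerm (A j) φ := fun j => by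
    ext x
    simp [covSpace, gaugeTerm]
  have hcovm : ∀ j, AEStronglyMeasurable (covSpace A φ j) volume := fun j =>
    (hE.memφ.2.memLp_weakPartial j).1.add (hAφm j)
  have hay := fun y => eLpNorm_three_sub_translate_le (d := g) (e := 0) (by simpa using ha) hb1
    (fun j => (ha j).locallyIntegrable_deriv.aestronglyMeasurable)
    (fun j => aestronglyMeasurable_zero) (fun j => (hg j).trans hbc) (fun j => by simp)
    (ha6.trans hbc) y
  have hφy := fun y => eLpNorm_three_sub_translate_le (d := covSpace A φ)
    (e := fun j => -gaugeTerm (A j) φ)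
    (fun j => hcov j ▸ hE.memφ.2.hasWeakPartial j) hb1 hcovm (fun j => (hAφm j).neg)
    (fun j => (hB.covSpace j).trans hbc) (fun j => by
      rw [eLpNorm_neg]
      exact ((eLpNorm_gaugeTerm_le (p := 6) (q := 6) (hE.memA j).1.1 hφm).trans
        (mul_le_mul' (hB.A j) hB.φ)).trans hbcc) (hB.φ.trans hbc) y
  have h3 : eLpNorm (gaugeTerm a φ) 3 volume ≤ b :=
    ((eLpNorm_gaugeTerm_le (p := 6) (q := 6) ham hφm).trans (mul_le_mul' ha6 hB.φ)).trans hbcc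
  have hmem : MemLp (gaugeTerm a φ) 3 volume :=
    ⟨aestronglyMeasurable_gaugeTerm ham hφm, h3.trans_lt ENNReal.coe_lt_top⟩
  refine ⟨hmem, h3.trans (ENNReal.coe_le_coe.2 le_self_add),
    (eLpNorm_two_sub_avg_lowKernel_le h13 ENNReal.ofNat_ne_top hmem (c := 234 * b ^ 3)
      fun y => ?_).trans (ENNReal.coe_le_coe.2 le_add_self)⟩
  refine (eLpNorm_two_gaugeTerm_sub_translate_le ham hφm (ha6.trans hbc) (hB.φ.trans hbc)
    (hay y) (hφy y)).trans (le_of_eq ?_)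
  push_cast
  ring

/-- If `f + u` and the high frequencies of `u` are in `L²`, so are the high frequencies of `f`, with
a bound that does not involve the norm of `f`. -/
theorem eLpNorm_sub_avg_lowKernel_le_of_add {f u : R3 → ℂ} (hf : MemLp f 2 volume)
    (hu : MemLp u 3 volume) {c c' : ℝ≥0} (hc : eLpNorm (f + u) 2 volume ≤ c)
    (hc' : eLpNorm (u - avg lowKernel u) 2 volume ≤ c') :
    eLpNorm (f - avg lowKernel f) 2 volume ≤ ((1 + lowMass) * c + c' : ℝ≥0) := by
  have h13 : (1 : ℝ≥0∞) ≤ 3 := by norm_num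
  have h2t : (2 : ℝ≥0∞) ≠ ∞ := ENNReal.ofNat_ne_top
  have h3t : (3 : ℝ≥0∞) ≠ ∞ := ENNReal.ofNat_ne_top
  have hfu : MemLp (f + u) 2 volume := ⟨hf.1.add hu.1, hc.trans_lt ENNReal.coe_lt_top⟩
  have e : f - avg lowKernel f =ᵐ[volume]
      ((f + u) - avg lowKernel (f + u)) - (u - avg lowKernel u) := by
    filter_upwards [avg_lowKernel_add one_le_two h2t h13 h3t hf hu] with x hx
    simp only [Pi.sub_apply, Pi.add_apply] at hx ⊢
    rw [hx]
    ring
  rw [eLpNorm_congr_ae e, ENNReal.coe_add]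
  exact (eLpNorm_sub_le (hfu.sub (memLp_avg_lowKernel one_le_two h2t hfu)).1
    (hu.sub (memLp_avg_lowKernel h13 h3t hu)).1 one_le_two).trans
    (add_le_add (eLpNorm_sub_avg_lowKernel_le one_le_two h2t hfu hc) hc')

end MKG

end

theorem lemma4p1 (K : ℝ≥0) :
    ∃ C : ℝ≥0, ∀ (A0 : MKG.R3 → ℝ) (A At : Fin 3 → MKG.R3 → ℝ) (φ φt : MKG.R3 → ℂ),
      MKG.IsEnergyClass A0 A At φ φt →
      MKG.IsDivergenceFree A → MKG.IsDivergenceFree At →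
      MKG.hamiltonian A0 A At φ φt ≤ K →
      (MKG.InBallH1AddL6 C (fun x => (A0 x : ℂ)) ∧
        (∀ k, MKG.InBallH1AddL6 C (fun x => (A k x : ℂ))) ∧
        MKG.InBallH1AddL6 C φ) ∧
      ((∀ j k, MKG.InBallL2AddL3 C (fun x => ((MKG.weakPartial j (A k) x : ℝ) : ℂ))) ∧
        (∀ k, MKG.InBallL2AddL3 C (fun x => (At k x : ℂ))) ∧
        (∀ j, MKG.InBallL2AddL3 C (MKG.weakPartial j φ)) ∧
        MKG.InBallL2AddL3 C φt) ∧
      ((∀ j, MKG.InBallL2 C (MKG.weakPartial j A0)) ∧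
        (∀ j k, MKG.InBallL2 C (MKG.weakPartial j (A k))) ∧
        (∀ k, MKG.InBallL2 C (At k))) := by
  obtain ⟨c, hc⟩ := MKG.exists_energyBounds K
  obtain ⟨c', hc'⟩ := MKG.exists_gaugeTerm_bounds c
  -- `d` dominates the bounds for the fields, for the gauge terms and for all high frequencies.
  set d : ℝ≥0 := (1 + MKG.lowMass) * c + c' with hd
  have hcd' : (1 + MKG.lowMass) * c ≤ d := le_self_add
  have hcd : c ≤ d := (le_mul_of_one_le_left zero_le le_self_add).trans hcd'
  have hcd2 : (c : ℝ≥0∞) ≤ d := ENNReal.coe_le_coe.2 hcd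
  have hc'd : (c' : ℝ≥0∞) ≤ d := ENNReal.coe_le_coe.2 le_add_self
  set C : ℝ≥0 := 10 * (1 + MKG.lowMass) ^ 2 * d + (2 + MKG.lowMass) * d with hC
  have hC1 : 10 * (1 + MKG.lowMass) ^ 2 * d ≤ C := le_self_add
  have hC1' : 10 * (1 + MKG.lowMass) ^ 2 * ((1 + MKG.lowMass) * c) ≤ C :=
    (mul_le_mul' le_rfl hcd').trans hC1
  have hC2 : (2 + MKG.lowMass) * d ≤ C := le_add_self
  have hC2' : (2 + MKG.lowMass) * c ≤ C := (mul_le_mul' le_rfl hcd).trans hC2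
  have hC3 : c ≤ C := (le_mul_of_one_le_left zero_le
    (one_le_two.trans le_self_add)).trans hC2'
  refine ⟨C, fun A0 A At φ φt hE hA hAt hH => ?_⟩
  have hB := hc A0 A At φ φt hE hA hAt hH
  have hφ := hE.memφ.2.memLp_weakPartial
  have hcov : ∀ j x, MKG.covSpace A φ j x
      = MKG.weakPartial j φ x + MKG.gaugeTerm (A j) φ x := fun j x => rfl
  have hcovt : ∀ x, MKG.covTime A0 φ φt x = φt x + MKG.gaugeTerm A0 φ x := fun x => rfl
  have hgA := fun j => hc' hE hB (hE.memA j).2.hasWeakPartial (fun k => hB.gradA k j) (hB.A j)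
  have hgA0 := hc' hE hB hE.memA0.1.hasWeakPartial hB.gradA0 hB.A0
  refine ⟨⟨?_, fun k => ?_, ?_⟩, ⟨fun j k => ?_, fun k => ?_, fun j => ?_, ?_⟩,
    fun j => ?_, fun j k => ?_, fun k => ?_⟩
  · exact (MKG.inBallH1AddL6_ofReal hE.memA0.1.hasWeakPartial hB.A0 hB.gradA0).mono hC1'
  · exact (MKG.inBallH1AddL6_ofReal (hE.memA k).2.hasWeakPartial (hB.A k)
      fun j => hB.gradA j k).mono hC1'
  · exact (MKG.inBallH1AddL6 hE.memφ.2.hasWeakPartial hφ (hB.φ.trans hcd2) fun j =>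
      MKG.eLpNorm_sub_avg_lowKernel_le_of_add (hφ j) (hgA j).1 (hB.covSpace j)
        (hgA j).2.2).mono hC1
  · exact (MKG.inBallL2AddL3_ofReal ((hE.memA k).2.memLp_weakPartial j) (hB.gradA j k)).mono hC2'
  · exact (MKG.inBallL2AddL3_ofReal (hE.memAt k) (hB.At k)).mono hC2'
  · exact (MKG.inBallL2AddL3_of_sub (hcov j)
      ⟨(hφ j).1.add (hgA j).1.1, (hB.covSpace j).trans_lt ENNReal.coe_lt_top⟩ (hgA j).1
      ((hB.covSpace j).trans hcd2) ((hgA j).2.1.trans hc'd) ((hgA j).2.2.trans hc'd)).mono hC2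
  · exact (MKG.inBallL2AddL3_of_sub hcovt
      ⟨hE.memφt.1.add hgA0.1.1, hB.covTime.trans_lt ENNReal.coe_lt_top⟩ hgA0.1
      (hB.covTime.trans hcd2) (hgA0.2.1.trans hc'd) (hgA0.2.2.trans hc'd)).mono hC2
  · exact ⟨hE.memA0.1.memLp_weakPartial j, (hB.gradA0 j).trans (ENNReal.coe_le_coe.2 hC3)⟩
  · exact ⟨(hE.memA k).2.memLp_weakPartial j, (hB.gradA j k).trans (ENNReal.coe_le_coe.2 hC3)⟩
  · exact ⟨hE.memAt k, (hB.At k).trans (ENNReal.coe_le_coe.2 hC3)⟩
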